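/- A locally compact hypergroup is a locally compact Hausdorff space $K$ with a bilinear, associative, weakly continuous convolution $*$ on the space $M(K)$ of bounded regular complex Borel measures, determined by the measures $\delta_x*\delta_y$ through $\int f\,d(\mu*\nu)=\int\!\!\int f(x*y)\,d\mu(x)\,d\nu(y)$, where $f(x*y)=\int f\,d(\delta_x*\delta_y)$, and such that: each $\delta_x*\delta_y$ is a regular probability measure with compact support; $(x,y)\mapsto\delta_x*\delta_y$ is weakly continuous; $(x,y)\mapsto\operatorname{supp}(\delta_x*\delta_y)$ is continuous for the Michael (Vietoris) topology on nonempty compact sets; there is an identity $e$ with $\delta_e*\delta_x=\delta_x*\delta_e=\delta_x$; and there is a continuous involution $x\mapsto\check x$ such that the image of $\delta_x*\delta_y$ under it is $\delta_{\check y}*\delta_{\check x}$, and $e\in\operatorname{supp}(\delta_x*\delta_y)$ if and only if $x=\check y$. Let $K$ be a locally compact hypergroup with a left-invariant Haar measure $\omega$, that is, a nonzero positive Radon measure with $\delta_x*\omega=\omega$ for all $x\in K$, and let $L^\infty(K)=L^\infty(K,\omega;\mathbb{C})$ with pointwise multiplication. Let $\sigma$ be a regular Borel probability measure on $K$ that is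 non-degenerate: $\bigcup_{n\ge 1}(\operatorname{supp}\sigma)^n$ is dense in $K$, where $A*B=\bigcup_{a\in A,\,b\in B}\operatorname{supp}(\delta_a*\delta_b)$ for $A,B\subseteq K$. Put $$(\sigma*f)(x)=\int_K f(\check y*x)\,d\sigma(y),\qquad H^\infty_\sigma(K)=\{f\in L^\infty(K):\ \sigma*f=f\}.$$ Then the following conditions are equivalent. (i) $H^\infty_\sigma(K)$ is a subalgebra of $L^\infty(K)$. (ii) $H^\infty_\sigma(K)=\mathbb{C}1$. -/

import Mathlib

open MeasureTheory TopologicalSpace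
open scoped ENNReal BoundedContinuousFunction

noncomputable section

/-! ### The algebra `L^∞` -/

namespace LInfty

variable {X : Type*} [MeasurableSpace X] (ω : Measure X)

/-- The pointwise (almost everywhere) product on `L^∞`. -/
instance instMul : Mul (Lp ℂ ∞ ω) where
  mul f g := ((Lp.memLp g).mul' (Lp.memLp f) : MemLp (fun x => f x * g x) ∞ ω).toLp

/-- The unit of `L^∞` is the class of the constant function `1`. -/
instance instOne : One (Lp ℂ ∞ ω) where
  one := (memLp_top_const (1 : ℂ) : MemLp (fun _ : X => (1 : ℂ)) ∞ ω).toLp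

variable {ω}

theorem coeFn_mul (f g : Lp ℂ ∞ ω) : ⇑(f * g) =ᵐ[ω] fun x => f x * g x :=
  MemLp.coeFn_toLp ((Lp.memLp g).mul' (Lp.memLp f) : MemLp (fun x => f x * g x) ∞ ω)

theorem coeFn_one : ⇑(1 : Lp ℂ ∞ ω) =ᵐ[ω] fun _ => 1 :=
  MemLp.coeFn_toLp (memLp_top_const (1 : ℂ) : MemLp (fun _ : X => (1 : ℂ)) ∞ ω)

variable (ω)

/-- `L^∞` is a commutative ring, with its usual additive structure. -/
instance instCommRing : CommRing (Lp ℂ ∞ ω) where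
  __ := (inferInstance : AddCommGroup (Lp ℂ ∞ ω))
  mul := (· * ·)
  one := 1
  mul_assoc f g h := Lp.ext <| by
    filter_upwards [coeFn_mul (f * g) h, coeFn_mul f g, coeFn_mul f (g * h), coeFn_mul g h]
      with x h1 h2 h3 h4
    rw [h1, h2, h3, h4, mul_assoc]
  mul_comm f g := Lp.ext <| by
    filter_upwards [coeFn_mul f g, coeFn_mul g f] with x h1 h2
    rw [h1, h2, mul_comm]
  one_mul f := Lp.ext <| by
    filter_upwards [coeFn_mul 1 f, coeFn_one (ω := ω)] with x h1 h2
    rw [h1, h2, one_mul]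
  mul_one f := Lp.ext <| by
    filter_upwards [coeFn_mul f 1, coeFn_one (ω := ω)] with x h1 h2
    rw [h1, h2, mul_one]
  zero_mul f := Lp.ext <| by
    filter_upwards [coeFn_mul 0 f, Lp.coeFn_zero ℂ ∞ ω] with x h1 h2
    rw [h1, h2, Pi.zero_apply, zero_mul]
  mul_zero f := Lp.ext <| by
    filter_upwards [coeFn_mul f 0, Lp.coeFn_zero ℂ ∞ ω] with x h1 h2
    rw [h1, h2, Pi.zero_apply, mul_zero]
  left_distrib f g h := Lp.ext <| by
    filter_upwards [coeFn_mul f (g + h), Lp.coeFn_add g h, Lp.coeFn_add (f * g) (f * h),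
      coeFn_mul f g, coeFn_mul f h] with x h1 h2 h3 h4 h5
    rw [h1, h2, h3, Pi.add_apply, Pi.add_apply, h4, h5, mul_add]
  right_distrib f g h := Lp.ext <| by
    filter_upwards [coeFn_mul (f + g) h, Lp.coeFn_add f g, Lp.coeFn_add (f * h) (g * h),
      coeFn_mul f h, coeFn_mul g h] with x h1 h2 h3 h4 h5
    rw [h1, h2, h3, Pi.add_apply, Pi.add_apply, h4, h5, add_mul]

theorem smul_mul' (c : ℂ) (f g : Lp ℂ ∞ ω) : c • f * g = c • (f * g) := Lp.ext <| by
  filter_upwards [coeFn_mul (c • f) g, Lp.coeFn_smul c f, Lp.coeFn_smul c (f * g), coeFn_mul f g]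
    with x h1 h2 h3 h4
  rw [h1, h2, h3, Pi.smul_apply, Pi.smul_apply, h4, smul_mul_assoc]

/-- `L^∞` is a complex algebra, with its usual scalar multiplication. -/
instance instAlgebra : Algebra ℂ (Lp ℂ ∞ ω) :=
  Algebra.ofModule (smul_mul' ω) fun c f g => by
    rw [mul_comm, smul_mul' ω, mul_comm g f]

end LInfty

/-! ### Locally compact hypergroups -/

/-- A hypergroup structure on a locally compact Hausdorff space `K`: `conv x y` is the measure
`δ_x * δ_y`. The bilinear, weakly continuous convolution of arbitrary bounded regular measures
is determined by these measures through `⟨μ * ν, f⟩ = ∫∫ ⟨δ_x * δ_y, f⟩ dμ(x) dν(y)`. -/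
class Hypergroup (K : Type*) [TopologicalSpace K] [T2Space K] [LocallyCompactSpace K]
    [MeasurableSpace K] [BorelSpace K] where
  /-- the convolution `δ_x * δ_y` of two point masses -/
  conv : K → K → ProbabilityMeasure K
  /-- the identity -/
  e : K
  /-- the involution `x ↦ x̌` -/
  inv : K → K
  regular_conv : ∀ x y, (conv x y : Measure K).Regular
  /-- `(x, y) ↦ δ_x * δ_y` is weakly continuous. -/
  continuous_conv : Continuous fun p : K × K => conv p.1 p.2
  /-- `(δ_x * δ_y) * δ_z = δ_x * (δ_y * δ_z)`. -/
  conv_assoc : ∀ (x y z : K) (f : K →ᵇ ℂ),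
    ∫ t, ∫ s, f s ∂(conv t z : Measure K) ∂(conv x y : Measure K) =
      ∫ t, ∫ s, f s ∂(conv x t : Measure K) ∂(conv y z : Measure K)
  /-- The supports are nonempty and compact, and they depend continuously on `(x, y)` for the
  Michael (Vietoris) topology. -/
  continuous_supp : ∃ S : K × K → NonemptyCompacts K, Continuous S ∧
    ∀ x y, (S (x, y) : Set K) = (conv x y : Measure K).support
  e_conv : ∀ x, (conv e x : Measure K) = Measure.dirac x
  conv_e : ∀ x, (conv x e : Measure K) = Measure.dirac x
  continuous_inv : Continuous inv
  inv_inv : ∀ x, inv (inv x) = x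
  map_inv_conv : ∀ x y, (conv x y : Measure K).map inv = (conv (inv y) (inv x) : Measure K)
  e_mem_support_iff : ∀ x y, e ∈ (conv x y : Measure K).support ↔ x = inv y

namespace Hypergroup

variable {K : Type*} [TopologicalSpace K] [T2Space K] [LocallyCompactSpace K]
  [MeasurableSpace K] [BorelSpace K] [Hypergroup K]

/-- `f(x * y) = ∫ f d(δ_x * δ_y)`. -/
def trans (f : K → ℂ) (x y : K) : ℂ := ∫ t, f t ∂(conv x y : Measure K)

/-- `(μ * f)(x) = ∫ f(y̌ * x) dμ(y)`. -/
def convFun (μ : Measure K) (f : K → ℂ) (x : K) : ℂ := ∫ y, trans f (inv y) x ∂μ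

/-- A left-invariant Haar measure: a nonzero positive Radon measure `ω` with `δ_x * ω = ω` for all
`x`, that is, `∫ f(x * y) dω(y) = ∫ f dω` for every continuous `f` with compact support. -/
structure IsLeftHaar (ω : Measure K) : Prop where
  regular : ω.Regular
  ne_zero : ω ≠ 0
  left_inv : ∀ (x : K) (f : K → ℂ), Continuous f → HasCompactSupport f →
    ∫ y, trans f x y ∂ω = ∫ y, f y ∂ω

/-- The product of subsets, `A * B = ⋃ supp (δ_a * δ_b)` over `a ∈ A`, `b ∈ B`. -/
def setMul (A B : Set K) : Set K := ⋃ a ∈ A, ⋃ b ∈ B, (conv a b : Measure K).support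

/-- The powers `A ^ n`, where `A ^ 0 = {e}`. -/
def setPow (A : Set K) : ℕ → Set K
  | 0 => {e}
  | n + 1 => setMul (setPow A n) A

/-- A positive measure is non-degenerate if `⋃ (supp μ) ^ n`, over `n ≥ 1`, is dense in `K`. -/
def IsNondegenerate (μ : Measure K) : Prop :=
  closure (⋃ n ≥ 1, setPow μ.support n) = Set.univ

/-- The space `H^∞_σ(K)` of all `f ∈ L^∞(K)` with `σ * f = f` in `L^∞(K)`. -/
def harmonicLInfty (ω σ : Measure K) : Set (Lp ℂ ∞ ω) :=
  {f | convFun σ f =ᵐ[ω] f}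

end Hypergroup

end

/-! Constants are harmonic because `σ` is a probability measure, so (ii) gives (i) at once. For the
converse, let `f` be a bounded harmonic function. The value at `x` of its right convolution by a
continuous density `φ` is the integral of `f` against `δ_x * φω`. This smoothing `F` is bounded and
continuous, and it is harmonic at every point because left and right convolutions commute
(`IsLeftHaar.integral_smoothing_convKernel`).

Harmonicity at `x` says that `F(x)` is the mean of `F` under the probability measure `σ̌ * δ_x`. The
conjugate of `F` is harmonic because `σ` is positive, so in a subalgebra `|F|²` is harmonic too.
Hence `F` has variance zero under `σ̌ * δ_x`, and by continuity it equals `F(x)` on the whole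
support. Moving from support to support along the powers of `supp σ`, which are dense, shows that
`F` is constant (`IsNondegenerate.eq_const`, `IsNondegenerate.eq_const_of_subalgebra`). Finally, an
approximate identity turns constancy of all smoothings into constancy of `f`
(`IsLeftHaar.ae_eq_const_of_smoothing`).

Two points need work. Left invariance of `ω` is given only as `∫ f(x * y) dω(y) = ∫ f dω`; the
adjoint relation `∫ f(x * y) g(y) dω(y) = ∫ f(y) g(x̌ * y) dω(y)` is derived from it in
`IsLeftHaar.integral_bind_withCcDensity`. Also, `K` is not assumed second countable, so
measurability for product σ-algebras cannot be relied on; convolutions are handled as vaguely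
continuous kernels of regular measures, and identities between them are tested on continuous
functions of compact support. -/

set_option linter.unusedSectionVars false

/-! ### Kernels of regular measures without second countability. -/

namespace MeasureTheory

open Filter Set
open scoped Topology NNReal ProbabilityTheory

/-- A kernel of uniformly bounded regular measures that is continuous for the vague topology. -/
structure IsFellerKernel {X Y : Type*} [TopologicalSpace X] [TopologicalSpace Y] [MeasurableSpace Y]
    (κ : X → Measure Y) : Prop where
  regular : ∀ x, (κ x).Regular
  bound : ∃ M : ℝ≥0, ∀ x, κ x univ ≤ M
  continuous_integral : ∀ g : Y → ℝ, Continuous g → HasCompactSupport g →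
    Continuous fun x => ∫ y, g y ∂κ x

section Radon

variable {X Y Z : Type*}
  [TopologicalSpace X] [T2Space X] [LocallyCompactSpace X] [MeasurableSpace X] [BorelSpace X]
  [TopologicalSpace Y] [T2Space Y] [LocallyCompactSpace Y] [MeasurableSpace Y] [BorelSpace Y]
  [TopologicalSpace Z] [T2Space Z] [LocallyCompactSpace Z] [MeasurableSpace Z] [BorelSpace Z]

/-- Finite regular measures are `τ`-additive on directed families of lower semicontinuous
functions. -/
theorem lintegral_le_iSup_of_directed (μ : Measure X) [IsFiniteMeasure μ] [μ.Regular]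
    {ι : Type*} [Nonempty ι] {h : ι → X → ℝ≥0∞} (hlsc : ∀ i, LowerSemicontinuous (h i))
    (hdir : Directed (· ≤ ·) h) {H : X → ℝ≥0} {M : ℝ≥0} (hM : ∀ x, H x ≤ M)
    (hH : ∀ x, ∀ r : ℝ≥0∞, r < H x → ∃ i, r < h i x) :
    ∫⁻ x, H x ∂μ ≤ ⨆ i, ∫⁻ x, h i x ∂μ := by
  have hfin : ∫⁻ x, H x ∂μ ≠ ∞ := by
    refine ne_top_of_le_ne_top (b := ∫⁻ _, (M : ℝ≥0∞) ∂μ) ?_ (lintegral_mono fun x => ?_)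
    · simpa using ENNReal.mul_ne_top ENNReal.coe_ne_top (measure_ne_top μ univ)
    · exact ENNReal.coe_le_coe.2 (hM x)
  refine ENNReal.le_of_forall_pos_le_add fun ε hε _ => ?_
  -- The error `ε` is spent in thirds: passing from `H` to an upper semicontinuous minorant `g`, the
  -- slack `δ` on a compact set `Q`, and the mass outside `Q`.
  obtain ⟨g, hgH, hg, hgi⟩ := exists_upperSemicontinuous_le_lintegral_le H hfin
    (ε := (ε / 3 : ℝ≥0)) (by simpa using hε.ne')
  obtain ⟨δ, hδ, hδε⟩ : ∃ δ : ℝ≥0, 0 < δ ∧ (δ : ℝ≥0∞) * μ univ < (ε / 3 : ℝ≥0) :=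
    ENNReal.exists_nnreal_pos_mul_lt (measure_ne_top μ univ) (by simpa using hε.ne')
  obtain ⟨η, hη, hηε⟩ : ∃ η : ℝ≥0, 0 < η ∧ (η : ℝ≥0∞) * M < (ε / 3 : ℝ≥0) :=
    ENNReal.exists_nnreal_pos_mul_lt ENNReal.coe_ne_top (by simpa using hε.ne')
  obtain ⟨Q, -, hQ, hμQ⟩ := MeasurableSet.univ.exists_isCompact_sdiff_lt (measure_ne_top μ univ)
    (ε := (η : ℝ≥0∞)) (by simpa using hη.ne')
  -- Semicontinuity of `g` and of the `h i` makes the interiors `U i` a directed open cover, so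
  -- compactness of `Q` leaves a single index.
  let U : ι → Set X := fun i => interior {x | (g x : ℝ≥0∞) ≤ h i x + δ}
  obtain ⟨i, hi⟩ : ∃ i, Q ⊆ U i := by
    refine hQ.elim_directed_cover U (fun i => isOpen_interior) (fun x _ => ?_) ?_
    · have hgc : ∀ᶠ y in 𝓝 x, g y < g x + δ / 2 := hg x _ (by simpa using hδ)
      have hlt : (g x + δ / 2 : ℝ≥0) < g x + δ := by
        gcongr
        exact NNReal.half_lt_self hδ.ne'
      rcases le_or_gt (g x + δ / 2) δ with hle | hgt
      · refine mem_iUnion.2 ⟨Classical.arbitrary ι, mem_interior_iff_mem_nhds.2 ?_⟩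
        filter_upwards [hgc] with y hy
        exact (ENNReal.coe_le_coe.2 (hy.le.trans hle)).trans le_add_self
      · have h1 : ((g x + δ / 2 - δ : ℝ≥0) : ℝ≥0∞) < H x := by
          refine lt_of_lt_of_le ?_ (ENNReal.coe_le_coe.2 (hgH x))
          rw [ENNReal.coe_lt_coe]
          exact (tsub_lt_iff_right hgt.le).2 hlt
        obtain ⟨i, hi⟩ := hH x _ h1
        refine mem_iUnion.2 ⟨i, mem_interior_iff_mem_nhds.2 ?_⟩
        filter_upwards [hgc, hlsc i x _ hi] with y hy hy'
        calc (g y : ℝ≥0∞) ≤ ((g x + δ / 2 - δ + δ : ℝ≥0) : ℝ≥0∞) := by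
              rw [tsub_add_cancel_of_le hgt.le]; exact_mod_cast hy.le
          _ ≤ h i y + δ := by rw [ENNReal.coe_add]; gcongr
    · intro i j
      obtain ⟨k, hik, hjk⟩ := hdir i j
      refine ⟨k, interior_mono fun x hx => ?_, interior_mono fun x hx => ?_⟩
      · exact le_trans hx (add_le_add_left (hik x) _)
      · exact le_trans hx (add_le_add_left (hjk x) _)
  have hQm := hQ.isClosed.measurableSet
  have h1 : ∫⁻ x in Q, g x ∂μ ≤ ∫⁻ x, h i x ∂μ + (ε / 3 : ℝ≥0) := by
    calc ∫⁻ x in Q, g x ∂μ ≤ ∫⁻ x in Q, (h i x + δ) ∂μ :=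
          setLIntegral_mono' hQm fun x hx => by
            have hx' := hi hx
            exact interior_subset (s := {x | (g x : ℝ≥0∞) ≤ h i x + δ}) hx'
      _ ≤ ∫⁻ x, (h i x + δ) ∂μ := setLIntegral_le_lintegral _ _
      _ = ∫⁻ x, h i x ∂μ + δ * μ univ := by
          rw [lintegral_add_right _ measurable_const, lintegral_const]
      _ ≤ _ := by gcongr
  have h2 : ∫⁻ x in Qᶜ, g x ∂μ ≤ (ε / 3 : ℝ≥0) := by
    calc ∫⁻ x in Qᶜ, g x ∂μ ≤ ∫⁻ _ in Qᶜ, (M : ℝ≥0∞) ∂μ :=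
          lintegral_mono fun x => ENNReal.coe_le_coe.2 ((hgH x).trans (hM x))
      _ = M * μ Qᶜ := by simp
      _ ≤ M * η := by
          gcongr
          rw [compl_eq_univ_sdiff]
          exact hμQ.le
      _ ≤ _ := by rw [mul_comm]; exact hηε.le
  calc ∫⁻ x, H x ∂μ ≤ ∫⁻ x in Q, g x ∂μ + ∫⁻ x in Qᶜ, g x ∂μ + (ε / 3 : ℝ≥0) := by
        rw [lintegral_add_compl _ hQm]; exact hgi
    _ ≤ ∫⁻ x, h i x ∂μ + (ε / 3 : ℝ≥0) + (ε / 3 : ℝ≥0) + (ε / 3 : ℝ≥0) := by gcongr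
    _ = ∫⁻ x, h i x ∂μ + ε := by
        rw [add_assoc, add_assoc, ← ENNReal.coe_add, ← ENNReal.coe_add]
        congr 2
        rw [← add_assoc, add_thirds]
    _ ≤ _ := by gcongr; exact le_iSup (fun i => ∫⁻ x, h i x ∂μ) i

/-- Most of the mass of a finite regular measure is seen by a compactly supported cutoff. -/
theorem exists_cutoff (μ : Measure X) [IsFiniteMeasure μ] [μ.Regular] {ε : ℝ} (hε : 0 < ε) :
    ∃ χ : X → ℝ, Continuous χ ∧ HasCompactSupport χ ∧ (∀ x, 0 ≤ χ x) ∧ (∀ x, χ x ≤ 1) ∧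
      ∫ x, (1 - χ x) ∂μ < ε := by
  obtain ⟨Q, -, hQ, hμQ⟩ := MeasurableSet.univ.exists_isCompact_sdiff_lt (measure_ne_top μ univ)
    (ε := ENNReal.ofReal ε) (by simpa using hε)
  obtain ⟨χ, h1, -, hχ, h01⟩ := exists_continuous_one_zero_of_isCompact hQ isClosed_empty
    (disjoint_empty Q)
  refine ⟨χ, χ.continuous, hχ, fun x => (h01 x).1, fun x => (h01 x).2, ?_⟩
  have hQm := hQ.isClosed.measurableSet
  calc ∫ x, (1 - χ x) ∂μ ≤ ∫ x, Qᶜ.indicator 1 x ∂μ := by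
        refine integral_mono ((integrable_const _).sub
          (χ.continuous.integrable_of_hasCompactSupport hχ))
          ((integrable_const (1 : ℝ)).indicator hQm.compl) fun x => ?_
        by_cases hx : x ∈ Q
        · simp [hx, h1 hx]
        · simp [hx, (h01 x).1]
    _ = μ.real Qᶜ := integral_indicator_one hQm.compl
    _ < ε := by
        rw [compl_eq_univ_sdiff, measureReal_def]
        exact (ENNReal.toReal_lt_of_lt_ofReal hμQ)

/-- Integrals of bounded jointly continuous functions against a finite regular measure depend
continuously on the parameter. -/
theorem continuous_integral_of_bounded (ν : Measure Y) [IsFiniteMeasure ν] [ν.Regular]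
    {P : Type*} [TopologicalSpace P]
    {G : P → Y → ℝ} (hG : Continuous G.uncurry) {M : ℝ} (hM : ∀ x y, ‖G x y‖ ≤ M) :
    Continuous fun x => ∫ y, G x y ∂ν := by
  have hGx : ∀ x, Continuous (G x) := fun x => hG.comp (Continuous.prodMk_right x)
  rcases isEmpty_or_nonempty P with hP | ⟨⟨p⟩⟩
  · exact continuous_of_const fun x => (hP.false x).elim
  rcases isEmpty_or_nonempty Y with hY | ⟨⟨y₀⟩⟩
  · simp only [integral_of_isEmpty]; exact continuous_const
  have hM0 : 0 ≤ M := (norm_nonneg _).trans (hM p y₀)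
  have hbd : ∀ f : Y → ℝ, Continuous f → (∀ y, ‖f y‖ ≤ M) → Integrable f ν := fun f hf hb =>
    Integrable.of_bound hf.aestronglyMeasurable M (.of_forall hb)
  refine continuous_of_uniform_approx_of_continuous fun u hu => ?_
  obtain ⟨ε, hε, hεu⟩ := Metric.mem_uniformity_dist.1 hu
  obtain ⟨χ, hχ, hχc, h0, h1, hint⟩ := exists_cutoff ν (ε := ε / (M + 1)) (by positivity)
  refine ⟨fun x => ∫ y, χ y * G x y ∂ν, ?_, fun x => hεu ?_⟩
  · rw [← continuousOn_univ]
    refine continuousOn_integral_of_compact_support hχc (k := tsupport χ) ?_ ?_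
    · exact ((hχ.comp continuous_snd).mul hG).continuousOn
    · intro x y _ hy
      simp [image_eq_zero_of_notMem_tsupport hy]
  · have hi2 : Integrable (fun y => χ y * G x y) ν := by
      refine hbd _ (hχ.mul (hGx x)) fun y => ?_
      rw [norm_mul, Real.norm_of_nonneg (h0 y)]
      exact (mul_le_of_le_one_left (norm_nonneg _) (h1 y)).trans (hM x y)
    rw [dist_eq_norm, ← integral_sub (hbd _ (hGx x) (hM x)) hi2]
    calc ‖∫ y, (G x y - χ y * G x y) ∂ν‖ ≤ ∫ y, (1 - χ y) * M ∂ν := by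
          refine norm_integral_le_of_norm_le ?_ (.of_forall fun y => ?_)
          · exact ((integrable_const _).sub (hχ.integrable_of_hasCompactSupport hχc)).mul_const _
          · rw [← one_sub_mul, norm_mul, Real.norm_of_nonneg (sub_nonneg.2 (h1 y))]
            exact mul_le_mul_of_nonneg_left (hM x y) (sub_nonneg.2 (h1 y))
      _ = (∫ y, (1 - χ y) ∂ν) * M := integral_mul_const _ _
      _ ≤ ε / (M + 1) * M := by gcongr
      _ < ε := by
          rw [div_mul_eq_mul_div, div_lt_iff₀ (by positivity)]
          nlinarith

/-- Truncating a bounded continuous function by cutoffs changes its iterated integral little. -/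
theorem norm_integral_integral_sub_cutoff_le (μ : Measure X) [IsFiniteMeasure μ]
    (ν : Measure Y) [IsFiniteMeasure ν] [ν.Regular]
    {G : X → Y → ℝ} (hG : Continuous G.uncurry) {M : ℝ} (hM : ∀ x y, ‖G x y‖ ≤ M)
    {χ : X → ℝ} (hχ : Continuous χ) (hχc : HasCompactSupport χ) (hχ0 : ∀ x, 0 ≤ χ x)
    (hχ1 : ∀ x, χ x ≤ 1)
    {ξ : Y → ℝ} (hξ : Continuous ξ) (hξc : HasCompactSupport ξ) (hξ0 : ∀ x, 0 ≤ ξ x)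
    (hξ1 : ∀ x, ξ x ≤ 1) :
    ‖∫ x, ∫ y, G x y ∂ν ∂μ - ∫ x, ∫ y, χ x * ξ y * G x y ∂ν ∂μ‖ ≤
      ((∫ x, (1 - χ x) ∂μ) * ν.real univ + μ.real univ * ∫ y, (1 - ξ y) ∂ν) * M := by
  have hGx : ∀ x, Continuous (G x) := fun x => hG.comp (Continuous.prodMk_right x)
  have hT : Continuous (fun x y => χ x * ξ y * G x y).uncurry :=
    ((hχ.comp continuous_fst).mul (hξ.comp continuous_snd)).mul hG
  have hTM : ∀ x y, ‖χ x * ξ y * G x y‖ ≤ M := fun x y => by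
    rw [norm_mul, norm_mul, Real.norm_of_nonneg (hχ0 x), Real.norm_of_nonneg (hξ0 y)]
    exact (mul_le_of_le_one_left (norm_nonneg _)
      (mul_le_one₀ (hχ1 x) (hξ0 y) (hξ1 y))).trans (hM x y)
  have hTx : ∀ x, Continuous fun y => χ x * ξ y * G x y := fun x =>
    hT.comp (Continuous.prodMk_right x)
  have hbd : ∀ f : Y → ℝ, Continuous f → (∀ y, ‖f y‖ ≤ M) → Integrable f ν := fun f hf hb =>
    Integrable.of_bound hf.aestronglyMeasurable M (.of_forall hb)
  have hbdX : ∀ f : X → Y → ℝ, Continuous f.uncurry → (∀ x y, ‖f x y‖ ≤ M) →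
      Integrable (fun x => ∫ y, f x y ∂ν) μ := fun f hf hb =>
    Integrable.of_bound (continuous_integral_of_bounded ν hf hb).aestronglyMeasurable
      (M * ν.real univ) (.of_forall fun x => norm_integral_le_of_norm_le_const (.of_forall (hb x)))
  have hiχ : Integrable (fun x => 1 - χ x) μ := (integrable_const (1 : ℝ)).sub (hχ.integrable_of_hasCompactSupport hχc (μ := μ))
  have hiξ : Integrable (fun x => 1 - ξ x) ν := (integrable_const (1 : ℝ)).sub (hξ.integrable_of_hasCompactSupport hξc (μ := ν))
  rw [← integral_sub (hbdX _ hG hM) (hbdX _ hT hTM)]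
  calc _ ≤ ∫ x, ((1 - χ x) * ν.real univ + ∫ y, (1 - ξ y) ∂ν) * M ∂μ := by
        refine norm_integral_le_of_norm_le
          (((hiχ.mul_const _).add (integrable_const _)).mul_const _) (.of_forall fun x => ?_)
        rw [← integral_sub (hbd _ (hGx x) (hM x)) (hbd _ (hTx x) (hTM x))]
        calc _ ≤ ∫ y, ((1 - χ x) + (1 - ξ y)) * M ∂ν := by
              refine norm_integral_le_of_norm_le
                (((integrable_const _).add hiξ).mul_const _) (.of_forall fun y => ?_)
              have h1 := hχ1 x; have h2 := hξ1 y; have h3 := hχ0 x; have h4 := hξ0 y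
              have h5 : 0 ≤ 1 - χ x * ξ y := sub_nonneg.2 (mul_le_one₀ h1 h4 h2)
              rw [← one_sub_mul, norm_mul, Real.norm_of_nonneg h5]
              refine mul_le_mul ?_ (hM x y) (norm_nonneg _) (by linarith)
              nlinarith
          _ = _ := by
              rw [integral_mul_const, integral_add (integrable_const _) hiξ, integral_const,
                smul_eq_mul, mul_comm (ν.real univ)]
    _ = _ := by
        rw [integral_mul_const, integral_add (hiχ.mul_const _) (integrable_const _),
          integral_mul_const, integral_const, smul_eq_mul]

/-- Fubini's theorem for bounded continuous functions and finite regular measures. -/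
theorem integral_integral_swap_of_continuous_of_bounded (μ : Measure X) [IsFiniteMeasure μ]
    [μ.Regular] (ν : Measure Y) [IsFiniteMeasure ν] [ν.Regular]
    {G : X → Y → ℝ} (hG : Continuous G.uncurry) {M : ℝ} (hM : ∀ x y, ‖G x y‖ ≤ M) :
    ∫ x, ∫ y, G x y ∂ν ∂μ = ∫ y, ∫ x, G x y ∂μ ∂ν := by
  rcases isEmpty_or_nonempty X with hX | ⟨⟨x₀⟩⟩
  · simp only [integral_of_isEmpty, integral_zero]
  rcases isEmpty_or_nonempty Y with hY | ⟨⟨y₀⟩⟩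
  · simp only [integral_of_isEmpty, integral_zero]
  have hM0 : 0 ≤ M := (norm_nonneg _).trans (hM x₀ y₀)
  set A := μ.real univ
  set B := ν.real univ
  have hA : 0 ≤ A := measureReal_nonneg
  have hB : 0 ≤ B := measureReal_nonneg
  refine eq_of_forall_dist_le fun ε hε => ?_
  -- With both cutoff errors below this constant `t`, truncation costs at most `t (A + B) M ≤ ε / 2`
  -- in either order of integration. The added ones keep the denominator positive.
  obtain ⟨χ, hχ, hχc, hχ0, hχ1, hχi⟩ :=
    exists_cutoff μ (ε := ε / (2 * (M + 1) * (A + B + 1))) (by positivity)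
  obtain ⟨ξ, hξ, hξc, hξ0, hξ1, hξi⟩ :=
    exists_cutoff ν (ε := ε / (2 * (M + 1) * (A + B + 1))) (by positivity)
  have e1 := norm_integral_integral_sub_cutoff_le μ ν hG hM hχ hχc hχ0 hχ1 hξ hξc hξ0 hξ1
  have e2 := norm_integral_integral_sub_cutoff_le ν μ (G := fun y x => G x y)
    (hG.comp continuous_swap) (fun y x => hM x y) hξ hξc hξ0 hξ1 hχ hχc hχ0 hχ1
  have hsw : ∫ x, ∫ y, χ x * ξ y * G x y ∂ν ∂μ = ∫ y, ∫ x, ξ y * χ x * G x y ∂μ ∂ν := by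
    rw [integral_integral_swap_of_hasCompactSupport]
    · simp only [mul_comm (χ _) (ξ _)]
    · exact ((hχ.comp continuous_fst).mul (hξ.comp continuous_snd)).mul hG
    · refine HasCompactSupport.intro (hχc.isCompact.prod hξc.isCompact) fun p hp => ?_
      rw [mem_prod, not_and_or] at hp
      rcases hp with hp | hp <;> simp [Function.uncurry, image_eq_zero_of_notMem_tsupport hp]
  rw [hsw] at e1
  have hbound : ((∫ x, (1 - χ x) ∂μ) * B + A * ∫ y, (1 - ξ y) ∂ν) * M ≤ ε / 2 := by
    set t := ε / (2 * (M + 1) * (A + B + 1)) with ht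
    have ht0 : 0 < t := by positivity
    have hteq : t * (A + B + 1) * (M + 1) = ε / 2 := by rw [ht]; field_simp
    calc _ ≤ (t * B + A * t) * M := by gcongr
      _ ≤ t * (A + B + 1) * (M + 1) := by
          have : 0 ≤ t * (A + B + 1) + t * M := by positivity
          nlinarith [this]
      _ = _ := hteq
  have hbound' : ((∫ y, (1 - ξ y) ∂ν) * A + B * ∫ x, (1 - χ x) ∂μ) * M ≤ ε / 2 := by
    refine le_of_eq_of_le ?_ hbound
    ring
  rw [dist_eq_norm]
  calc _ = ‖(∫ x, ∫ y, G x y ∂ν ∂μ - ∫ y, ∫ x, ξ y * χ x * G x y ∂μ ∂ν) -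
        (∫ y, ∫ x, G x y ∂μ ∂ν - ∫ y, ∫ x, ξ y * χ x * G x y ∂μ ∂ν)‖ := by congr 1; ring
    _ ≤ _ := norm_sub_le _ _
    _ ≤ ε / 2 + ε / 2 := add_le_add (e1.trans hbound) (e2.trans hbound')
    _ = ε := add_halves ε

namespace IsFellerKernel

variable {κ : X → Measure Y}

theorem isFiniteMeasure (hκ : IsFellerKernel κ) (x : X) : IsFiniteMeasure (κ x) :=
  ⟨(hκ.bound.choose_spec x).trans_lt ENNReal.coe_lt_top⟩

/-- Inner regularity places a compact `Q` inside `U`, and a bump function between `Q` and `U`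
transfers vague continuity to the mass of `U`. This also makes the kernel measurable, as open sets
form a generating π-system. -/
theorem lowerSemicontinuous_measure (hκ : IsFellerKernel κ) {U : Set Y} (hU : IsOpen U) :
    LowerSemicontinuous fun x => κ x U := by
  intro x r hr
  have := hκ.regular x
  have := hκ.isFiniteMeasure
  obtain ⟨Q, hQU, hQ, hrQ⟩ := hU.exists_lt_isCompact hr
  obtain ⟨g, hg1, hg0, hgc, hg01⟩ := exists_continuous_one_zero_of_isCompact hQ hU.isClosed_compl
    (disjoint_compl_right_iff_subset.2 hQU)
  have hi : ∀ z, Integrable g (κ z) := fun z =>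
    Integrable.of_bound g.continuous.aestronglyMeasurable 1 (.of_forall fun y => by
      rw [Real.norm_of_nonneg (hg01 y).1]; exact (hg01 y).2)
  have hlow : (κ x).real Q ≤ ∫ y, g y ∂κ x := by
    rw [← integral_indicator_one hQ.isClosed.measurableSet]
    refine integral_mono ((integrable_const (1 : ℝ)).indicator hQ.isClosed.measurableSet) (hi x)
      fun y => ?_
    by_cases hy : y ∈ Q
    · simp [hy, hg1 hy]
    · simp [hy, (hg01 y).1]
  have hup : ∀ z, ∫ y, g y ∂κ z ≤ (κ z).real U := fun z => by
    rw [← integral_indicator_one hU.measurableSet]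
    refine integral_mono (hi z) ((integrable_const (1 : ℝ)).indicator hU.measurableSet)
      fun y => ?_
    by_cases hy : y ∈ U
    · simp [hy, (hg01 y).2]
    · simp [hy, hg0 hy]
  have hr' : r.toReal < ∫ y, g y ∂κ x :=
    lt_of_lt_of_le ((ENNReal.toReal_lt_toReal hrQ.ne_top (measure_ne_top _ _)).2 hrQ) hlow
  filter_upwards [(hκ.continuous_integral g g.continuous hgc).continuousAt.eventually_const_lt hr']
    with z hz
  exact (ENNReal.toReal_lt_toReal hrQ.ne_top (measure_ne_top _ _)).1 (hz.trans_le (hup z))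

theorem measurable (hκ : IsFellerKernel κ) : Measurable κ := by
  have := hκ.isFiniteMeasure
  exact Measurable.measure_of_isPiSystem (S := {U : Set Y | IsOpen U})
    (BorelSpace.measurable_eq (α := Y)) isPiSystem_isOpen
    (fun U hU => (hκ.lowerSemicontinuous_measure hU).measurable)
    (hκ.lowerSemicontinuous_measure isOpen_univ).measurable

theorem bind_apply (hκ : IsFellerKernel κ) (μ : Measure X) {s : Set Y} (hs : MeasurableSet s) :
    μ.bind κ s = ∫⁻ x, κ x s ∂μ :=
  Measure.bind_apply hs hκ.measurable.aemeasurable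

theorem isFiniteMeasure_bind (hκ : IsFellerKernel κ) (μ : Measure X) [IsFiniteMeasure μ] :
    IsFiniteMeasure (μ.bind κ) := by
  obtain ⟨M, hM⟩ := hκ.bound
  refine ⟨?_⟩
  rw [hκ.bind_apply μ .univ]
  calc _ ≤ ∫⁻ _, (M : ℝ≥0∞) ∂μ := lintegral_mono fun x => hM x
    _ < ∞ := by
      rw [lintegral_const]
      exact ENNReal.mul_lt_top ENNReal.coe_lt_top (measure_lt_top _ _)

/-- An open `U` is exhausted by the open sets `V` with compact closure in `U`. This family is
directed but may be uncountable, so monotone convergence is replaced by τ-additivity. -/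
theorem regular_bind (hκ : IsFellerKernel κ) (μ : Measure X) [IsFiniteMeasure μ] [μ.Regular] :
    (μ.bind κ).Regular := by
  have := hκ.isFiniteMeasure_bind μ
  have := hκ.isFiniteMeasure
  have hreg : Measure.InnerRegularWRT (μ.bind κ) IsCompact IsOpen := by
    intro U hU r hr
    obtain ⟨M, hM⟩ := hκ.bound
    let ι := {V : Set Y // IsOpen V ∧ IsCompact (closure V) ∧ closure V ⊆ U}
    have : Nonempty ι := ⟨⟨∅, isOpen_empty, by simp, by simp⟩⟩
    have key : ∫⁻ x, κ x U ∂μ ≤ ⨆ V : ι, ∫⁻ x, κ x V.1 ∂μ := by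
      have hcoe : ∀ x, (((κ x U).toNNReal : ℝ≥0) : ℝ≥0∞) = κ x U := fun x =>
        ENNReal.coe_toNNReal (measure_ne_top _ _)
      have := lintegral_le_iSup_of_directed μ (h := fun (V : ι) x => κ x V.1)
        (fun V => hκ.lowerSemicontinuous_measure V.2.1)
        (fun V W => ⟨⟨V.1 ∪ W.1, V.2.1.union W.2.1, by
          rw [closure_union]; exact V.2.2.1.union W.2.2.1, by
          rw [closure_union]; exact union_subset V.2.2.2 W.2.2.2⟩,
          fun x => measure_mono subset_union_left, fun x => measure_mono subset_union_right⟩)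
        (H := fun x => (κ x U).toNNReal) (M := M)
        (fun x => by
          rw [← ENNReal.coe_le_coe, hcoe]; exact (measure_mono (subset_univ _)).trans (hM x))
        (fun x r hr => by
          rw [hcoe] at hr
          have := hκ.regular x
          obtain ⟨Q, hQU, hQ, hrQ⟩ := hU.exists_lt_isCompact hr
          obtain ⟨V, hV, hQV, hVU, hVc⟩ := exists_open_between_and_isCompact_closure hQ hU hQU
          exact ⟨⟨V, hV, hVc, hVU⟩, hrQ.trans_le (measure_mono hQV)⟩)
      simpa only [hcoe] using this
    rw [hκ.bind_apply μ hU.measurableSet] at hr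
    obtain ⟨V, hV⟩ := lt_iSup_iff.1 (hr.trans_le key)
    refine ⟨closure V.1, V.2.2.2, V.2.2.1, ?_⟩
    rw [← hκ.bind_apply μ V.2.1.measurableSet] at hV
    exact hV.trans_le (measure_mono subset_closure)
  have := Measure.InnerRegularWRT.weaklyRegular_of_finite (μ.bind κ) fun U hU r hr => by
    obtain ⟨Q, hQU, hQ, hrQ⟩ := hreg hU r hr
    exact ⟨Q, hQU, hQ.isClosed, hrQ⟩
  exact { innerRegular := hreg }

theorem integral_bind (hκ : IsFellerKernel κ) (μ : Measure X) [IsFiniteMeasure μ]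
    {E : Type*} [NormedAddCommGroup E] [NormedSpace ℝ E] {f : Y → E}
    (hf : Integrable f (μ.bind κ)) :
    ∫ y, f y ∂μ.bind κ = ∫ x, ∫ y, f y ∂κ x ∂μ := by
  let k : ProbabilityTheory.Kernel X Y := ⟨κ, hκ.measurable⟩
  have : ProbabilityTheory.IsFiniteKernel k := by
    obtain ⟨M, hM⟩ := hκ.bound
    exact ⟨⟨M, ENNReal.coe_lt_top, hM⟩⟩
  have h : μ.bind κ = (k ∘ₖ ProbabilityTheory.Kernel.const Unit μ) () := by
    rw [ProbabilityTheory.Kernel.comp_apply, ProbabilityTheory.Kernel.const_apply]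
    rfl
  rw [h] at hf ⊢
  rw [ProbabilityTheory.Kernel.integral_comp hf, ProbabilityTheory.Kernel.const_apply]
  rfl

theorem integral_bind_of_bounded (hκ : IsFellerKernel κ) (μ : Measure X) [IsFiniteMeasure μ]
    {E : Type*} [NormedAddCommGroup E] [NormedSpace ℝ E] {f : Y → E}
    (hf : StronglyMeasurable f) {C : ℝ} (hC : ∀ y, ‖f y‖ ≤ C) :
    ∫ y, f y ∂μ.bind κ = ∫ x, ∫ y, f y ∂κ x ∂μ :=
  have := hκ.isFiniteMeasure_bind μ
  hκ.integral_bind μ (Integrable.of_bound hf.aestronglyMeasurable C (.of_forall hC))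

end IsFellerKernel

end Radon
end MeasureTheory

/-! ### Composition of kernels, supports, and continuous densities. -/

namespace MeasureTheory

open Filter Set
open scoped Topology NNReal

section Radon

variable {X Y Z : Type*}
  [TopologicalSpace X] [T2Space X] [LocallyCompactSpace X] [MeasurableSpace X] [BorelSpace X]
  [TopologicalSpace Y] [T2Space Y] [LocallyCompactSpace Y] [MeasurableSpace Y] [BorelSpace Y]
  [TopologicalSpace Z] [T2Space Z] [LocallyCompactSpace Z] [MeasurableSpace Z] [BorelSpace Z]

theorem ext_of_integral_eq_of_hasCompactSupport {μ ν : Measure X} [μ.Regular] [ν.Regular]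
    (h : ∀ g : X → ℝ, Continuous g → HasCompactSupport g → ∫ x, g x ∂μ = ∫ x, g x ∂ν) : μ = ν :=
  Measure.ext_of_integral_eq_on_compactlySupported fun f => h f f.continuous f.hasCompactSupport


namespace IsFellerKernel

variable {κ : X → Y → Measure Z}

theorem comp {P Q : Type*} [TopologicalSpace P] [TopologicalSpace Q] {κ : P → Measure Z}
    (hκ : IsFellerKernel κ) {f : Q → P} (hf : Continuous f) : IsFellerKernel fun q => κ (f q) where
  regular _ := hκ.regular _
  bound := ⟨hκ.bound.choose, fun _ => hκ.bound.choose_spec _⟩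
  continuous_integral g hg hgc := (hκ.continuous_integral g hg hgc).comp hf

theorem left (hκ : IsFellerKernel (Function.uncurry κ)) (y : Y) : IsFellerKernel fun x => κ x y :=
  hκ.comp (Continuous.prodMk_left y)

theorem right (hκ : IsFellerKernel (Function.uncurry κ)) (x : X) : IsFellerKernel (κ x) :=
  hκ.comp (Continuous.prodMk_right x)

theorem swap (hκ : IsFellerKernel (Function.uncurry κ)) :
    IsFellerKernel (Function.uncurry fun y x => κ x y) :=
  hκ.comp continuous_swap

theorem exists_norm_integral_le {P : Type*} [TopologicalSpace P] {κ : P → Measure Z}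
    (hκ : IsFellerKernel κ) {g : Z → ℝ} (hg : Continuous g) (hgc : HasCompactSupport g) :
    ∃ C, ∀ p, ‖∫ z, g z ∂κ p‖ ≤ C := by
  obtain ⟨M, hM⟩ := hκ.bound
  have := fun p => IsFiniteMeasure.mk ((hM p).trans_lt ENNReal.coe_lt_top)
  obtain ⟨C, hC⟩ := hgc.exists_bound_of_continuous hg
  refine ⟨|C| * M, fun p => ?_⟩
  refine (norm_integral_le_of_norm_le_const (C := |C|)
    (.of_forall fun z => (hC z).trans (le_abs_self C))).trans ?_
  exact mul_le_mul_of_nonneg_left (ENNReal.toReal_le_coe_of_le_coe (hM p)) (abs_nonneg C)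

/-- Averaging a jointly Feller kernel over one of its variables gives a Feller kernel. -/
theorem bind (hκ : IsFellerKernel (Function.uncurry κ)) (ν : Measure Y) [IsFiniteMeasure ν]
    [ν.Regular] : IsFellerKernel fun x => ν.bind (κ x) where
  regular x := (hκ.right x).regular_bind ν
  bound := by
    obtain ⟨M, hM⟩ := hκ.bound
    refine ⟨M * (ν univ).toNNReal, fun x => ?_⟩
    rw [(hκ.right x).bind_apply ν .univ, ENNReal.coe_mul, ENNReal.coe_toNNReal (measure_ne_top _ _)]
    calc _ ≤ ∫⁻ _, (M : ℝ≥0∞) ∂ν := lintegral_mono fun y => hM (x, y)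
      _ = _ := lintegral_const _
  continuous_integral g hg hgc := by
    obtain ⟨C, hC⟩ := hgc.exists_bound_of_continuous hg
    obtain ⟨B, hB⟩ := hκ.exists_norm_integral_le hg hgc
    simp_rw [fun x => (hκ.right x).integral_bind_of_bounded ν
      (hg.stronglyMeasurable_of_hasCompactSupport hgc) hC]
    exact continuous_integral_of_bounded ν (G := fun x y => ∫ z, g z ∂κ x y)
      (hκ.continuous_integral g hg hgc) fun x y => hB (x, y)

/-- The kernel need not be measurable for the product σ-algebra. Both sides are regular, so it
suffices to integrate test functions, where Fubini for bounded continuous functions applies. -/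
theorem bind_bind_comm (hκ : IsFellerKernel (Function.uncurry κ))
    (μ : Measure X) [IsFiniteMeasure μ] [μ.Regular] (ν : Measure Y) [IsFiniteMeasure ν]
    [ν.Regular] :
    μ.bind (fun x => ν.bind (κ x)) = ν.bind (fun y => μ.bind fun x => κ x y) := by
  have h1 := hκ.bind ν
  have h2 := hκ.swap.bind μ
  have := h1.regular_bind μ
  have := h2.regular_bind ν
  refine ext_of_integral_eq_of_hasCompactSupport fun g hg hgc => ?_
  obtain ⟨C, hC⟩ := hgc.exists_bound_of_continuous hg
  obtain ⟨B, hB⟩ := hκ.exists_norm_integral_le hg hgc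
  have hgm := hg.stronglyMeasurable_of_hasCompactSupport hgc
  rw [h1.integral_bind_of_bounded μ hgm hC, h2.integral_bind_of_bounded ν hgm hC]
  simp_rw [fun x => (hκ.right x).integral_bind_of_bounded ν hgm hC,
    fun y => (hκ.left y).integral_bind_of_bounded μ hgm hC]
  exact integral_integral_swap_of_continuous_of_bounded μ ν (G := fun x y => ∫ z, g z ∂κ x y)
      (hκ.continuous_integral g hg hgc) fun x y => hB (x, y)

/-- Positivity of `κ x U` at one point of the support persists nearby by lower semicontinuity, and
`μ` charges that neighbourhood; conversely `μ` is carried by its support. Supports of convolutions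
are computed with this. -/
theorem measure_bind_pos_iff {κ : X → Measure Y} (hκ : IsFellerKernel κ) (μ : Measure X)
    [IsFiniteMeasure μ] [μ.Regular] {U : Set Y} (hU : IsOpen U) :
    0 < μ.bind κ U ↔ ∃ x ∈ μ.support, 0 < κ x U := by
  rw [hκ.bind_apply μ hU.measurableSet,
    lintegral_pos_iff_support ((hκ.lowerSemicontinuous_measure hU).measurable)]
  constructor
  · intro h
    by_contra! hcon
    refine h.ne' (measure_mono_null (fun x hx => ?_) Measure.measure_compl_support_of_regular)
    exact fun hxs => hx (le_antisymm (hcon x hxs) (zero_le))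
  · rintro ⟨x, hx, hxU⟩
    refine (Measure.mem_support_iff_forall x).1 hx _ ?_
    filter_upwards [hκ.lowerSemicontinuous_measure hU x 0 hxU] with z hz using hz.ne'

end IsFellerKernel

theorem measure_pos_iff_support_inter_nonempty {μ : Measure X} [μ.Regular] {U : Set X}
    (hU : IsOpen U) : 0 < μ U ↔ (μ.support ∩ U).Nonempty := by
  constructor
  · intro h
    by_contra hcon
    refine h.ne' (measure_mono_null (fun x hx => ?_) Measure.measure_compl_support_of_regular)
    exact fun hxs => hcon ⟨x, hxs, hx⟩
  · rintro ⟨x, hx, hxU⟩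
    exact (Measure.mem_support_iff_forall x).1 hx U (hU.mem_nhds hxU)

/-- The measure with a nonnegative, compactly supported, continuous density. -/
noncomputable def Measure.withCcDensity (ω : Measure X) (φ : X → ℝ) : Measure X :=
  ω.withDensity fun x => ENNReal.ofReal (φ x)

variable {ω : Measure X} {φ : X → ℝ}

theorem Measure.withCcDensity_absolutelyContinuous (ω : Measure X) (φ : X → ℝ) :
    ω.withCcDensity φ ≪ ω :=
  withDensity_absolutelyContinuous _ _

theorem integral_withCcDensity (hφ : Continuous φ) (hφ0 : ∀ x, 0 ≤ φ x)
    {E : Type*} [NormedAddCommGroup E] [NormedSpace ℝ E] (f : X → E) :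
    ∫ x, f x ∂ω.withCcDensity φ = ∫ x, φ x • f x ∂ω := by
  rw [Measure.withCcDensity, integral_withDensity_eq_integral_toReal_smul
    hφ.measurable.ennreal_ofReal (.of_forall fun x => ENNReal.ofReal_lt_top)]
  simp only [ENNReal.toReal_ofReal (hφ0 _)]

theorem isFiniteMeasure_withCcDensity [IsFiniteMeasureOnCompacts ω] (hφ : Continuous φ)
    (hφc : HasCompactSupport φ) : IsFiniteMeasure (ω.withCcDensity φ) :=
  isFiniteMeasure_withDensity_ofReal (hφ.integrable_of_hasCompactSupport hφc).2

/-- `ω` may be infinite, but only its restriction to `tsupport φ` matters, where it is finite; the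
bound `B` on `φ` converts an `ω`-small remainder into a small one for the density. -/
theorem regular_withCcDensity [ω.Regular] (hφ : Continuous φ)
    (hφc : HasCompactSupport φ) : (ω.withCcDensity φ).Regular := by
  have := isFiniteMeasure_withCcDensity (ω := ω) hφ hφc
  have : (ω.withCcDensity φ).InnerRegularCompactLTTop := by
    refine ⟨fun s hs r hr => ?_⟩
    have hsm := hs.1
    have hC : MeasurableSet (tsupport φ) := (isClosed_tsupport φ).measurableSet
    obtain ⟨B, hB⟩ := hφc.exists_bound_of_continuous hφ
    have hle : ∀ t, MeasurableSet t → ω.withCcDensity φ t ≤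
        ENNReal.ofReal B * ω (t ∩ tsupport φ) := fun t ht => by
      rw [Measure.withCcDensity, withDensity_apply _ ht]
      calc ∫⁻ x in t, ENNReal.ofReal (φ x) ∂ω
          ≤ ∫⁻ x in t, (tsupport φ).indicator (fun _ => ENNReal.ofReal B) x ∂ω := by
            refine lintegral_mono fun x => ?_
            by_cases hx : x ∈ tsupport φ
            · simpa [hx] using ENNReal.ofReal_le_ofReal ((le_abs_self _).trans (hB x))
            · simp [hx, image_eq_zero_of_notMem_tsupport hx]
        _ = _ := by
            rw [lintegral_indicator hC, lintegral_const, Measure.restrict_restrict hC,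
              Measure.restrict_apply_univ, inter_comm]
    have hfin : ω (s ∩ tsupport φ) ≠ ∞ :=
      ((measure_mono inter_subset_right).trans_lt hφc.isCompact.measure_lt_top).ne
    obtain ⟨δ, hδ, hδr⟩ : ∃ δ : ℝ≥0, 0 < δ ∧ (δ : ℝ≥0∞) * ENNReal.ofReal B <
        ω.withCcDensity φ s - r :=
      ENNReal.exists_nnreal_pos_mul_lt ENNReal.ofReal_ne_top (tsub_pos_of_lt hr).ne'
    obtain ⟨Q, hQs, hQ, hQd⟩ := (hsm.inter hC).exists_isCompact_sdiff_lt hfin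
      (ε := (δ : ℝ≥0∞)) (by simpa using hδ.ne')
    refine ⟨Q, hQs.trans inter_subset_left, hQ, ?_⟩
    have h1 : ω.withCcDensity φ (s \ Q) ≤ δ * ENNReal.ofReal B := by
      refine (hle _ (hsm.diff hQ.isClosed.measurableSet)).trans ?_
      rw [mul_comm]
      gcongr
      refine (measure_mono fun x hx => ?_).trans hQd.le
      exact ⟨⟨hx.1.1, hx.2⟩, hx.1.2⟩
    have h2 : ω.withCcDensity φ s ≤ ω.withCcDensity φ Q + ω.withCcDensity φ (s \ Q) := by
      rw [← measure_union disjoint_sdiff_right (hsm.diff hQ.isClosed.measurableSet)]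
      exact measure_mono fun x hx => by by_cases h : x ∈ Q <;> simp [h, hx]
    by_contra hcon
    rw [not_lt] at hcon
    have h3 : ω.withCcDensity φ s < r + (ω.withCcDensity φ s - r) :=
      (h2.trans (add_le_add hcon h1)).trans_lt
        (ENNReal.add_lt_add_left (hr.ne_top) hδr)
    rw [add_tsub_cancel_of_le hr.le] at h3
    exact lt_irrefl _ h3
  infer_instance

end Radon
end MeasureTheory

/-! ### Calculus of supports and σ-compactness. -/

namespace Hypergroup

open Filter Set
open scoped Topology NNReal

section Support

variable {K : Type*} [TopologicalSpace K] [T2Space K] [LocallyCompactSpace K]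
  [MeasurableSpace K] [BorelSpace K] [Hypergroup K]

instance (x y : K) : (conv x y : Measure K).Regular := regular_conv x y

theorem continuous_integral_conv {g : K → ℝ} (hg : Continuous g) {C : ℝ} (hC : ∀ x, ‖g x‖ ≤ C) :
    Continuous fun p : K × K => ∫ t, g t ∂(conv p.1 p.2 : Measure K) :=
  (ProbabilityMeasure.continuous_integral_boundedContinuousFunction
    (BoundedContinuousFunction.ofNormedAddCommGroup g hg C hC)).comp continuous_conv

theorem isFellerKernel_conv :
    IsFellerKernel (Function.uncurry fun x y : K => (conv x y : Measure K)) where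
  regular p := regular_conv p.1 p.2
  bound := ⟨1, fun p => by simp [Function.uncurry]⟩
  continuous_integral g hg hgc := by
    obtain ⟨C, hC⟩ := hgc.exists_bound_of_continuous hg
    exact continuous_integral_conv hg hC

theorem isFellerKernel_conv_left (y : K) : IsFellerKernel fun x : K => (conv x y : Measure K) :=
  isFellerKernel_conv.left y

theorem isFellerKernel_conv_right (x : K) : IsFellerKernel fun y : K => (conv x y : Measure K) :=
  isFellerKernel_conv.right x

/-- Associativity of the convolution of point masses, as an identity of measures. -/
theorem bind_conv_assoc (x y z : K) :
    (conv x y : Measure K).bind (fun t => (conv t z : Measure K)) =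
      (conv y z : Measure K).bind (fun t => (conv x t : Measure K)) := by
  have h1 := isFellerKernel_conv_left z
  have h2 := isFellerKernel_conv_right x
  have := h1.regular_bind (conv x y : Measure K)
  have := h2.regular_bind (conv y z : Measure K)
  refine ext_of_integral_eq_of_hasCompactSupport fun g hg hgc => ?_
  obtain ⟨C, hC⟩ := hgc.exists_bound_of_continuous hg
  have hgm := hg.stronglyMeasurable_of_hasCompactSupport hgc
  rw [h1.integral_bind_of_bounded _ hgm hC, h2.integral_bind_of_bounded _ hgm hC]
  have h := conv_assoc x y z (BoundedContinuousFunction.ofNormedAddCommGroup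
    (fun x => (g x : ℂ)) (Complex.continuous_ofReal.comp hg) C fun x => by simpa using hC x)
  simp only [BoundedContinuousFunction.coe_ofNormedAddCommGroup, integral_complex_ofReal] at h
  exact_mod_cast h

theorem exists_continuous_support : ∃ S : K × K → NonemptyCompacts K, Continuous S ∧
    ∀ p : K × K, (S p : Set K) = (conv p.1 p.2 : Measure K).support :=
  let ⟨S, hS, h⟩ := continuous_supp (K := K)
  ⟨S, hS, fun p => h p.1 p.2⟩

theorem isCompact_support (x y : K) : IsCompact (conv x y : Measure K).support := by
  obtain ⟨S, -, hS⟩ := exists_continuous_support (K := K)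
  rw [← hS (x, y)]
  exact (S (x, y)).isCompact

theorem support_nonempty (x y : K) : (conv x y : Measure K).support.Nonempty := by
  obtain ⟨S, -, hS⟩ := exists_continuous_support (K := K)
  rw [← hS (x, y)]
  exact (S (x, y)).nonempty

theorem isOpen_support_inter_nonempty {U : Set K} (hU : IsOpen U) :
    IsOpen {p : K × K | ((conv p.1 p.2 : Measure K).support ∩ U).Nonempty} := by
  obtain ⟨S, hSc, hS⟩ := exists_continuous_support (K := K)
  simp_rw [← hS]
  exact (NonemptyCompacts.isOpen_inter_nonempty_of_isOpen hU).preimage hSc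

theorem isOpen_support_subset {U : Set K} (hU : IsOpen U) :
    IsOpen {p : K × K | (conv p.1 p.2 : Measure K).support ⊆ U} := by
  obtain ⟨S, hSc, hS⟩ := exists_continuous_support (K := K)
  simp_rw [← hS]
  exact (NonemptyCompacts.isOpen_subsets_of_isOpen hU).preimage hSc

theorem mem_setMul {A B : Set K} {t : K} :
    t ∈ setMul A B ↔ ∃ a ∈ A, ∃ b ∈ B, t ∈ (conv a b : Measure K).support := by
  simp [setMul]

/-- The supports over `A × B` form a compact set of compacts in the Vietoris topology, and the union
of such a set is compact. -/
theorem isCompact_setMul {A B : Set K} (hA : IsCompact A) (hB : IsCompact B) :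
    IsCompact (setMul A B) := by
  obtain ⟨S, hSc, hS⟩ := exists_continuous_support (K := K)
  have h := Compacts.isCompact_biUnion_coe_of_isCompact
    (((hA.prod hB).image hSc).image NonemptyCompacts.continuous_toCompacts)
  convert h using 1
  ext t
  rw [mem_setMul, mem_iUnion₂]
  constructor
  · rintro ⟨a, ha, b, hb, ht⟩
    refine ⟨_, ⟨_, ⟨(a, b), ⟨ha, hb⟩, rfl⟩, rfl⟩, ?_⟩
    rw [NonemptyCompacts.coe_toCompacts, hS]
    exact ht
  · rintro ⟨_, ⟨_, ⟨⟨a, b⟩, hab, rfl⟩, rfl⟩, ht⟩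
    rw [NonemptyCompacts.coe_toCompacts, hS] at ht
    exact ⟨a, hab.1, b, hab.2, ht⟩

theorem inv_mem_support {x y t : K} (ht : t ∈ (conv x y : Measure K).support) :
    inv t ∈ (conv (inv y) (inv x) : Measure K).support := by
  rw [Measure.mem_support_iff_forall] at ht ⊢
  intro U hU
  rw [← map_inv_conv]
  exact (ht _ (continuous_inv.continuousAt.preimage_mem_nhds hU)).trans_le
    (Measure.le_map_apply continuous_inv.measurable.aemeasurable U)

/-- If `t ∈ x * y` then `y ∈ x̌ * t`. -/
theorem mem_support_inv_left {x y t : K} (ht : t ∈ (conv x y : Measure K).support) :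
    y ∈ (conv (inv x) t : Measure K).support := by
  suffices h : inv y ∈ (conv (inv t) x : Measure K).support by
    simpa only [inv_inv] using inv_mem_support h
  by_contra hcon
  have hclosed : IsClosed (setMul (conv (inv t) x : Measure K).support {y}) :=
    (isCompact_setMul (isCompact_support _ _) isCompact_singleton).isClosed
  have he : e ∉ setMul (conv (inv t) x : Measure K).support {y} := by
    rw [mem_setMul]
    rintro ⟨s, hs, y', rfl, h⟩
    rw [e_mem_support_iff] at h
    exact hcon (h ▸ hs)
  -- Here `e ∈ ť * t` with `t ∈ x * y`, so `δ_ť * (δ_x * δ_y)` charges every neighbourhood of `e`.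
  -- Reassociated, the same measure lives on `(ť * x) * y`, which is closed and misses `e` unless
  -- `y̌ ∈ ť * x`.
  have hpos : 0 < (conv x y : Measure K).bind (fun s => (conv (inv t) s : Measure K))
      (setMul (conv (inv t) x : Measure K).support {y})ᶜ := by
    rw [(isFellerKernel_conv_right (inv t)).measure_bind_pos_iff _ hclosed.isOpen_compl]
    refine ⟨t, ht, ?_⟩
    rw [measure_pos_iff_support_inter_nonempty hclosed.isOpen_compl]
    exact ⟨e, (e_mem_support_iff _ _).2 rfl, he⟩
  rw [← bind_conv_assoc, (isFellerKernel_conv_left y).measure_bind_pos_iff _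
    hclosed.isOpen_compl] at hpos
  obtain ⟨s, hs, hsU⟩ := hpos
  rw [measure_pos_iff_support_inter_nonempty hclosed.isOpen_compl] at hsU
  obtain ⟨r, hr, hrU⟩ := hsU
  exact hrU (mem_setMul.2 ⟨s, hs, y, rfl, hr⟩)

/-- If `t ∈ x * y` then `x ∈ t * y̌`. -/
theorem mem_support_inv_right {x y t : K} (ht : t ∈ (conv x y : Measure K).support) :
    x ∈ (conv t (inv y) : Measure K).support := by
  simpa only [inv_inv] using inv_mem_support (mem_support_inv_left (inv_mem_support ht))

theorem e_mem_support_inv_left (x : K) : e ∈ (conv (inv x) x : Measure K).support :=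
  (e_mem_support_iff _ _).2 rfl

theorem e_mem_support_inv_right (x : K) : e ∈ (conv x (inv x) : Measure K).support :=
  (e_mem_support_iff _ _).2 (inv_inv x).symm

theorem inv_e : inv (e : K) = e := by
  have h := e_mem_support_inv_right (e : K)
  rw [e_conv] at h
  by_contra hne
  have := (Measure.mem_support_iff_forall _).1 h {inv e}ᶜ
    (isOpen_compl_singleton.mem_nhds fun h => hne h.symm)
  simp at this

theorem setMul_mono {A A' B B' : Set K} (hA : A ⊆ A') (hB : B ⊆ B') :
    setMul A B ⊆ setMul A' B' := fun t ht => by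
  obtain ⟨a, ha, b, hb, h⟩ := mem_setMul.1 ht
  exact mem_setMul.2 ⟨a, hA ha, b, hB hb, h⟩

/-- This uses the lower half of Vietoris continuity: an open set meeting `a * b` also meets `a' *
b'` for all nearby `(a', b')`. -/
theorem setMul_closure_subset (A B : Set K) :
    setMul (closure A) (closure B) ⊆ closure (setMul A B) := by
  intro t ht
  obtain ⟨a, ha, b, hb, h⟩ := mem_setMul.1 ht
  refine mem_closure_iff.2 fun U hU htU => ?_
  have hab : (a, b) ∈ closure (A ×ˢ B) := by rw [closure_prod_eq]; exact ⟨ha, hb⟩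
  obtain ⟨⟨a', b'⟩, ⟨s, hs, hsU⟩, ha', hb'⟩ :=
    mem_closure_iff.1 hab _ (isOpen_support_inter_nonempty hU) ⟨t, h, htU⟩
  exact ⟨s, hsU, mem_setMul.2 ⟨a', ha', b', hb', hs⟩⟩

theorem setPow_subset_closure {A B : Set K} (h : A ⊆ closure B) (n : ℕ) :
    setPow A n ⊆ closure (setPow B n) := by
  induction n with
  | zero => exact subset_closure
  | succ n ih => exact (setMul_mono ih h).trans (setMul_closure_subset _ _)

theorem isSigmaCompact_setMul {A B : Set K} (hA : IsSigmaCompact A) (hB : IsSigmaCompact B) :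
    IsSigmaCompact (setMul A B) := by
  obtain ⟨P, hP, rfl⟩ := hA
  obtain ⟨Q, hQ, rfl⟩ := hB
  have : setMul (⋃ i, P i) (⋃ j, Q j) = ⋃ p : ℕ × ℕ, setMul (P p.1) (Q p.2) := by
    ext t
    simp only [mem_setMul, mem_iUnion, Prod.exists]
    constructor
    · rintro ⟨a, ⟨i, ha⟩, b, ⟨j, hb⟩, h⟩
      exact ⟨i, j, a, ha, b, hb, h⟩
    · rintro ⟨i, j, a, ha, b, hb, h⟩
      exact ⟨a, ⟨i, ha⟩, b, ⟨j, hb⟩, h⟩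
  rw [this]
  exact isSigmaCompact_iUnion _ fun p => (isCompact_setMul (hP _) (hQ _)).isSigmaCompact

theorem isSigmaCompact_setPow {A : Set K} (hA : IsSigmaCompact A) (n : ℕ) :
    IsSigmaCompact (setPow A n) := by
  induction n with
  | zero => exact isCompact_singleton.isSigmaCompact
  | succ n ih => exact isSigmaCompact_setMul ih hA

/-- A hypergroup carrying a non-degenerate finite regular measure is `σ`-compact. -/
theorem IsNondegenerate.sigmaCompactSpace {σ : Measure K} [IsFiniteMeasure σ] [σ.Regular]
    (hσ : IsNondegenerate σ) : SigmaCompactSpace K := by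
  have hex : ∀ n : ℕ, ∃ Q : Set K, Q ⊆ univ ∧ IsCompact Q ∧ σ (univ \ Q) < (n + 1 : ℝ≥0∞)⁻¹ :=
    fun n => MeasurableSet.univ.exists_isCompact_sdiff_lt (measure_ne_top σ univ)
      (by simp)
  choose Q _ hQ hσQ using hex
  have hA : IsSigmaCompact (⋃ n, Q n) := isSigmaCompact_iUnion_of_isCompact _ hQ
  have hnull : σ (⋃ n, Q n)ᶜ = 0 := by
    refine le_antisymm (ENNReal.le_of_forall_pos_le_add fun ε hε _ => ?_) (zero_le)
    obtain ⟨n, hn⟩ := ENNReal.exists_inv_nat_lt (a := ε) (by simpa using hε.ne')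
    rw [zero_add]
    calc σ (⋃ n, Q n)ᶜ ≤ σ (univ \ Q n) := measure_mono fun x hx =>
          ⟨trivial, fun h => hx (mem_iUnion.2 ⟨n, h⟩)⟩
      _ ≤ (n + 1 : ℝ≥0∞)⁻¹ := (hσQ n).le
      _ ≤ (n : ℝ≥0∞)⁻¹ := ENNReal.inv_le_inv.2 le_self_add
      _ ≤ ε := hn.le
  have hsupp : σ.support ⊆ closure (⋃ n, Q n) := by
    intro x hx
    refine mem_closure_iff.2 fun U hU hxU => ?_
    by_contra hcon
    refine ((Measure.mem_support_iff_forall x).1 hx U (hU.mem_nhds hxU)).ne' ?_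
    exact measure_mono_null (fun z hz hzQ => hcon ⟨z, hz, hzQ⟩) hnull
  -- The support of `σ` need not be σ-compact, so its powers are replaced by those of a σ-compact
  -- set of full measure, whose closure contains the support.
  set D : Set K := ⋃ n, setPow (⋃ n, Q n) n with hDdef
  have hD : IsSigmaCompact D := isSigmaCompact_iUnion _ fun n => isSigmaCompact_setPow hA n
  have hdense : Dense D := by
    rw [dense_iff_closure_eq, ← univ_subset_iff, ← hσ]
    refine closure_minimal (iUnion₂_subset fun n _ => ?_) isClosed_closure
    exact (setPow_subset_closure hsupp n).trans
      (closure_mono (subset_iUnion (fun n => setPow (⋃ n, Q n) n) n))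
  obtain ⟨V, hV, hVe⟩ := exists_compact_mem_nhds (e : K)
  -- The `t` for which `ť * x` meets the interior of `V` form an open set containing `x`, hence
  -- meeting `D`; then `v ∈ ť * x` gives `x ∈ t * v`.
  have huniv : setMul D V = univ := by
    refine eq_univ_of_forall fun x => ?_
    have hopen : IsOpen {t : K | ((conv (inv t) x : Measure K).support ∩ interior V).Nonempty} :=
      (isOpen_support_inter_nonempty isOpen_interior).preimage
        (f := fun t : K => (inv t, x)) (continuous_inv.prodMk continuous_const)
    obtain ⟨t, ⟨v, hv, hvV⟩, htD⟩ := hdense.inter_open_nonempty _ hopen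
      ⟨x, e, e_mem_support_inv_left x, mem_interior_iff_mem_nhds.2 hVe⟩
    refine mem_setMul.2 ⟨t, htD, v, interior_subset hvV, ?_⟩
    simpa only [inv_inv] using mem_support_inv_left hv
  rw [← isSigmaCompact_univ_iff, ← huniv]
  exact isSigmaCompact_setMul hD hV.isSigmaCompact

end Support
end Hypergroup

/-! ### Left Haar measures: full support and the adjoint relation. -/

namespace MeasureTheory

open Filter Set
open scoped Topology NNReal

theorem integral_pos_of_mem_support {X : Type*} [TopologicalSpace X] [MeasurableSpace X]
    {μ : Measure X} {k : X → ℝ} (hk : Continuous k) (hk0 : ∀ x, 0 ≤ k x) (hi : Integrable k μ)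
    {x : X} (hx : x ∈ μ.support) (hkx : 0 < k x) : 0 < ∫ y, k y ∂μ := by
  rw [integral_pos_iff_support_of_nonneg hk0 hi]
  refine (Measure.mem_support_iff_forall x).1 hx _ ?_
  filter_upwards [hk.continuousAt.eventually_const_lt hkx] with y hy using hy.ne'

theorem abs_integral_sub_integral_le {X : Type*} [MeasurableSpace X] {μ : Measure X}
    [IsFiniteMeasure μ] {F G : X → ℝ} (hF : Integrable F μ) (hG : Integrable G μ) {c : ℝ}
    (h : ∀ᵐ x ∂μ, |F x - G x| ≤ c) : |∫ x, F x ∂μ - ∫ x, G x ∂μ| ≤ c * μ.real univ := by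
  rw [← integral_sub hF hG]
  exact norm_integral_le_of_norm_le_const (f := fun x => F x - G x) h

end MeasureTheory

namespace Hypergroup

open Filter Set
open scoped Topology NNReal

section Haar

variable {K : Type*} [TopologicalSpace K] [T2Space K] [LocallyCompactSpace K]
  [MeasurableSpace K] [BorelSpace K] [Hypergroup K]

/-- `k(x * y) = ∫ k d(δ_x * δ_y)` for real functions. -/
noncomputable def realTrans (k : K → ℝ) (x y : K) : ℝ := ∫ t, k t ∂(conv x y : Measure K)

theorem realTrans_nonneg {k : K → ℝ} (hk0 : ∀ x, 0 ≤ k x) (x y : K) : 0 ≤ realTrans k x y :=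
  integral_nonneg hk0

theorem norm_realTrans_le {k : K → ℝ} {C : ℝ} (hC : ∀ x, ‖k x‖ ≤ C) (x y : K) :
    ‖realTrans k x y‖ ≤ C := by
  simpa [realTrans] using
    norm_integral_le_of_norm_le_const (μ := (conv x y : Measure K)) (.of_forall hC)

theorem continuous_realTrans {k : K → ℝ} (hk : Continuous k) (hkc : HasCompactSupport k) :
    Continuous fun p : K × K => realTrans k p.1 p.2 := by
  obtain ⟨C, hC⟩ := hkc.exists_bound_of_continuous hk
  exact continuous_integral_conv hk hC

theorem ae_mem_support (x y : K) :
    ∀ᵐ t ∂(conv x y : Measure K), t ∈ (conv x y : Measure K).support :=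
  Measure.support_mem_ae_of_regular

theorem exists_mem_support_of_realTrans_ne_zero {k : K → ℝ} {x y : K}
    (h : realTrans k x y ≠ 0) : ∃ t ∈ (conv x y : Measure K).support, k t ≠ 0 := by
  by_contra! hcon
  refine h (integral_eq_zero_of_ae ?_)
  filter_upwards [ae_mem_support x y] with t ht using hcon t ht

/-- Keeps the supports of translates inside one compact set while `x̌` ranges over a compact `Q`. -/
theorem mem_setMul_of_realTrans_ne_zero {k : K → ℝ} {x y : K} {Q : Set K} (hx : inv x ∈ Q)
    (h : realTrans k x y ≠ 0) : y ∈ setMul Q (tsupport k) := by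
  obtain ⟨t, ht, hkt⟩ := exists_mem_support_of_realTrans_ne_zero h
  exact mem_setMul.2 ⟨inv x, hx, t, subset_tsupport _ hkt, mem_support_inv_left ht⟩

theorem hasCompactSupport_realTrans {k : K → ℝ} (hkc : HasCompactSupport k) (x : K) :
    HasCompactSupport (realTrans k x) := by
  refine HasCompactSupport.intro (isCompact_setMul (isCompact_singleton (x := inv x)) hkc)
    fun y hy => ?_
  by_contra h
  exact hy (mem_setMul_of_realTrans_ne_zero rfl h)

/-- The involution carries `δ_ť * δ_s` to `δ_š * δ_t`, and `k` is invariant under it. -/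
theorem realTrans_inv_comm {k : K → ℝ} (hk : Continuous k) (hks : ∀ x, k (inv x) = k x)
    (s t : K) : realTrans k (inv s) t = realTrans k (inv t) s := by
  have h := map_inv_conv (inv t) s
  rw [inv_inv] at h
  rw [realTrans, ← h, integral_map continuous_inv.measurable.aemeasurable
    hk.measurable.aestronglyMeasurable]
  simp only [hks]
  rfl

theorem integral_comp_inv_conv {g : K → ℝ} (hg : Continuous g) (x s : K) :
    ∫ u, g (inv u) ∂(conv (inv s) x : Measure K) = realTrans g (inv x) s := by
  have h := map_inv_conv (inv s) x
  rw [inv_inv] at h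
  rw [realTrans, ← h, integral_map continuous_inv.measurable.aemeasurable
    hg.measurable.aestronglyMeasurable]

variable {ω : Measure K}

theorem IsLeftHaar.integral_realTrans (hω : IsLeftHaar ω) {k : K → ℝ} (hk : Continuous k)
    (hkc : HasCompactSupport k) (x : K) : ∫ y, realTrans k x y ∂ω = ∫ y, k y ∂ω := by
  have h := hω.left_inv x (fun y => (k y : ℂ)) (Complex.continuous_ofReal.comp hk)
    (hkc.comp_left Complex.ofReal_zero)
  simp only [trans, integral_complex_ofReal] at h
  exact_mod_cast h

/-- Any `x` lies in `z * t₀` for a point `t₀` of the support and a suitable `z`. A bump at `x`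
inside a null open set would have integral zero, while its translate by `z` is positive at `t₀` and
has the same integral. -/
theorem IsLeftHaar.isOpenPosMeasure (hω : IsLeftHaar ω) : ω.IsOpenPosMeasure := by
  have := hω.regular
  refine ⟨fun U hU ⟨x, hx⟩ hU0 => ?_⟩
  obtain ⟨t₀, ht₀⟩ : ω.support.Nonempty := by
    by_contra hcon
    refine hω.ne_zero (Measure.measure_univ_eq_zero.1 ?_)
    have h := Measure.measure_compl_support_of_regular (μ := ω)
    rwa [not_nonempty_iff_eq_empty.1 hcon, compl_empty] at h
  obtain ⟨z, hz⟩ := support_nonempty x (inv t₀)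
  have hxz : x ∈ (conv z t₀ : Measure K).support := by
    simpa only [inv_inv] using mem_support_inv_right hz
  obtain ⟨k, hk1, hk0, hkc, hk01⟩ := exists_continuous_one_zero_of_isCompact
    (isCompact_singleton (x := x)) hU.isClosed_compl (by simpa using hx)
  have hkx : k x = 1 := hk1 rfl
  have hpos : 0 < realTrans k z t₀ :=
    integral_pos_of_mem_support k.continuous (fun y => (hk01 y).1)
      (k.continuous.integrable_of_hasCompactSupport hkc) hxz (by rw [hkx]; exact one_pos)
  have hcont : Continuous (realTrans k z) :=
    (continuous_realTrans k.continuous hkc).comp (Continuous.prodMk_right z)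
  have h1 : 0 < ∫ y, realTrans k z y ∂ω :=
    integral_pos_of_mem_support hcont (realTrans_nonneg (fun y => (hk01 y).1) z)
      (hcont.integrable_of_hasCompactSupport (hasCompactSupport_realTrans hkc z)) ht₀ hpos
  rw [hω.integral_realTrans k.continuous hkc] at h1
  refine h1.ne' (integral_eq_zero_of_ae ?_)
  have : ∀ᵐ y ∂ω, y ∈ Uᶜ := by simpa [ae_iff] using hU0
  filter_upwards [this] with y hy using hk0 hy

theorem support_conv_e_subset (t : K) : (conv t e : Measure K).support ⊆ {t} := by
  rw [conv_e]
  intro s hs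
  by_contra hne
  have := (Measure.mem_support_iff_forall _).1 hs {t}ᶜ
    (isOpen_compl_singleton.mem_nhds hne)
  simp at this

/-- Continuous functions vary little on `t * v` for `v` near the identity, uniformly for `t` in a
compact set. -/
theorem eventually_dist_lt {f : K → ℝ} (hf : Continuous f) {Q : Set K} (hQ : IsCompact Q)
    {ε : ℝ} (hε : 0 < ε) :
    ∀ᶠ v in 𝓝 (e : K), ∀ t ∈ Q, ∀ s ∈ (conv t v : Measure K).support, |f s - f t| < ε := by
  refine hQ.eventually_forall_of_forall_eventually fun t _ => ?_
  have hW : IsOpen {s | |f s - f t| < ε / 2} :=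
    isOpen_lt (hf.sub continuous_const).abs continuous_const
  have htW : t ∈ {s | |f s - f t| < ε / 2} := by simpa using hε
  have h1 : ∀ᶠ p : K × K in 𝓝 (e, t),
      (conv p.2 p.1 : Measure K).support ⊆ {s | |f s - f t| < ε / 2} :=
    ((isOpen_support_subset hW).preimage continuous_swap).mem_nhds
      ((support_conv_e_subset t).trans (singleton_subset_iff.2 htW))
  have h2 : ∀ᶠ p : K × K in 𝓝 (e, t), p.2 ∈ {s | |f s - f t| < ε / 2} :=
    (hW.preimage continuous_snd).mem_nhds htW
  filter_upwards [h1, h2] with p hp1 hp2 s hs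
  have a := abs_lt.1 (show |f s - f t| < ε / 2 from hp1 hs)
  have b := abs_lt.1 (show |f p.2 - f t| < ε / 2 from hp2)
  exact abs_lt.2 ⟨by linarith, by linarith⟩

/-- Symmetric bump functions at the identity. -/
theorem IsLeftHaar.exists_symmetric_bump (hω : IsLeftHaar ω) {V : Set K} (hV : V ∈ 𝓝 (e : K)) :
    ∃ k : K → ℝ, Continuous k ∧ HasCompactSupport k ∧ (∀ x, 0 ≤ k x) ∧ (∀ x, k (inv x) = k x) ∧
      (∀ x, k x ≠ 0 → x ∈ V) ∧ 0 < ∫ x, k x ∂ω := by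
  have := hω.regular
  have := hω.isOpenPosMeasure
  obtain ⟨k, hk1, hk0, hkc, hk01⟩ := exists_continuous_one_zero_of_isCompact
    (isCompact_singleton (x := (e : K))) (isOpen_interior (s := V)).isClosed_compl
    (by simpa using mem_interior_iff_mem_nhds.2 hV)
  have hke : k e = 1 := hk1 rfl
  have hc : Continuous fun x => k x * k (inv x) :=
    k.continuous.mul (k.continuous.comp continuous_inv)
  have hcc : HasCompactSupport fun x => k x * k (inv x) := hkc.mul_right
  have h0 : ∀ x, 0 ≤ k x * k (inv x) := fun x => mul_nonneg (hk01 _).1 (hk01 _).1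
  refine ⟨fun x => k x * k (inv x), hc, hcc, h0, fun x => ?_, fun x hx => ?_, ?_⟩
  · simp only [inv_inv, mul_comm]
  · by_contra hxV
    have hkx : k x = 0 := hk0 fun h => hxV (interior_subset h)
    exact hx (by simp [hkx])
  · exact integral_pos_of_mem_support (x := e) hc h0 (hc.integrable_of_hasCompactSupport hcc)
      (by rw [Measure.support_eq_univ]; trivial) (by simp [inv_e, hke])

/-- Integrating `f` against translates of a bump function nearly evaluates `f`. -/
theorem IsLeftHaar.exists_nhds_abs_integral_sub_le (hω : IsLeftHaar ω) {f : K → ℝ}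
    (hf : Continuous f) {Q : Set K} (hQ : IsCompact Q) {ε : ℝ} (hε : 0 < ε) :
    ∃ V ∈ 𝓝 (e : K), ∀ k : K → ℝ, Continuous k → HasCompactSupport k → (∀ x, 0 ≤ k x) →
      (∀ x, k x ≠ 0 → x ∈ V) → ∀ t ∈ Q,
        |∫ s, f s * realTrans k (inv t) s ∂ω - f t * ∫ x, k x ∂ω| ≤ ε * ∫ x, k x ∂ω := by
  have := hω.regular
  refine ⟨_, eventually_dist_lt hf hQ hε, fun k hk hkc hk0 hkV t ht => ?_⟩
  have hcont : Continuous (realTrans k (inv t)) :=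
    (continuous_realTrans hk hkc).comp (Continuous.prodMk_right _)
  have hcc := hasCompactSupport_realTrans hkc (inv t)
  have hi := hcont.integrable_of_hasCompactSupport hcc (μ := ω)
  have hi2 : Integrable (fun s => f s * realTrans k (inv t) s) ω :=
    (hf.mul hcont).integrable_of_hasCompactSupport hcc.mul_left
  -- Left invariance gives `s ↦ k(ť * s)` the same mass as `k`. It is nonzero only for `s ∈ t * v`
  -- with `v ∈ V`, where `f s` is within `ε` of `f t`.
  rw [← hω.integral_realTrans hk hkc (inv t), ← integral_const_mul, ← integral_const_mul,
    ← integral_sub hi2 (hi.const_mul _)]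
  rw [← Real.norm_eq_abs]
  refine norm_integral_le_of_norm_le (hi.const_mul _) (.of_forall fun s => ?_)
  rw [← sub_mul, norm_mul, Real.norm_of_nonneg (realTrans_nonneg hk0 _ _)]
  by_cases h : realTrans k (inv t) s = 0
  · simp [h]
  · obtain ⟨v, hv, hkv⟩ := exists_mem_support_of_realTrans_ne_zero h
    have hs := mem_support_inv_left hv
    rw [inv_inv] at hs
    exact mul_le_mul_of_nonneg_right (hkV v hkv t ht s hs).le (realTrans_nonneg hk0 _ _)

/-- Convolving a measure on the left by `δ_x` and then by `δ_y` amounts to convolving it by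
`δ_y * δ_x`. -/
theorem bind_conv_bind_conv (ν : Measure K) [IsFiniteMeasure ν] [ν.Regular] (x y : K) :
    (ν.bind fun z => (conv x z : Measure K)).bind (fun t => (conv y t : Measure K)) =
      (conv y x : Measure K).bind fun u => ν.bind fun z => (conv u z : Measure K) := by
  rw [Measure.bind_bind (isFellerKernel_conv_right x).measurable.aemeasurable
    (isFellerKernel_conv_right y).measurable.aemeasurable]
  simp_rw [← bind_conv_assoc]
  exact (isFellerKernel_conv.bind_bind_comm (conv y x : Measure K) ν).symm

theorem support_withCcDensity_subset (ω : Measure K) (φ : K → ℝ) :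
    (ω.withCcDensity φ).support ⊆ tsupport φ := by
  intro x hx
  by_contra hxt
  refine ((Measure.mem_support_iff_forall x).1 hx _
    ((isClosed_tsupport φ).isOpen_compl.mem_nhds hxt)).ne' ?_
  rw [Measure.withCcDensity, withDensity_apply _ (isClosed_tsupport φ).measurableSet.compl]
  rw [setLIntegral_congr_fun (g := fun _ => 0) (isClosed_tsupport φ).measurableSet.compl]
  · simp
  · intro y hy
    simp [image_eq_zero_of_notMem_tsupport hy]

theorem ae_mem_setMul_bind_withCcDensity [ω.Regular] {g : K → ℝ} (hg : Continuous g)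
    (hgc : HasCompactSupport g) (x : K) :
    ∀ᵐ t ∂(ω.withCcDensity g).bind (fun y => (conv x y : Measure K)),
      t ∈ setMul {x} (tsupport g) := by
  have := isFiniteMeasure_withCcDensity (ω := ω) hg hgc
  have := regular_withCcDensity (ω := ω) hg hgc
  have hopen : IsOpen (setMul {x} (tsupport g))ᶜ :=
    (isCompact_setMul isCompact_singleton hgc).isClosed.isOpen_compl
  have h := (isFellerKernel_conv_right x).measure_bind_pos_iff (ω.withCcDensity g) hopen
  rw [ae_iff]
  by_contra hne
  obtain ⟨y, hy, hyU⟩ := h.1 (pos_iff_ne_zero.2 hne)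
  obtain ⟨t, ht, htU⟩ := (measure_pos_iff_support_inter_nonempty hopen).1 hyU
  exact htU (mem_setMul.2 ⟨x, rfl, y, support_withCcDensity_subset _ _ hy, ht⟩)

/-- The adjoint relation between translations with respect to a left Haar measure. -/
theorem IsLeftHaar.integral_bind_withCcDensity (hω : IsLeftHaar ω) {f g : K → ℝ}
    (hf : Continuous f) (hfc : HasCompactSupport f) (hg : Continuous g)
    (hgc : HasCompactSupport g) (hg0 : ∀ x, 0 ≤ g x) (x : K) :
    ∫ t, f t ∂(ω.withCcDensity g).bind (fun y => (conv x y : Measure K)) =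
      ∫ s, f s * realTrans g (inv x) s ∂ω := by
  have := hω.regular
  have := isFiniteMeasure_withCcDensity (ω := ω) hg hgc
  have := regular_withCcDensity (ω := ω) hg hgc
  have hFx := isFellerKernel_conv_right x
  set ρ := (ω.withCcDensity g).bind (fun y => (conv x y : Measure K)) with hρ
  have hρfin : IsFiniteMeasure ρ := hFx.isFiniteMeasure_bind _
  have hρreg : ρ.Regular := hFx.regular_bind _
  have hfi : Integrable f ω := hf.integrable_of_hasCompactSupport hfc
  -- The two evaluations below cost `ε N ρ(K)` and `ε N ∫ |f|`; `c` collects both, plus one for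
  -- positivity.
  set c := ρ.real univ + ∫ s, |f s| ∂ω + 1 with hc
  have hc0 : 0 < c := by
    have : 0 ≤ ∫ s, |f s| ∂ω := integral_nonneg fun _ => abs_nonneg _
    have : 0 ≤ ρ.real univ := measureReal_nonneg
    positivity
  refine eq_of_forall_dist_le fun δ hδ => ?_
  set ε := δ / c with hε
  have hε0 : 0 < ε := by positivity
  obtain ⟨V₁, hV₁, h₁⟩ := hω.exists_nhds_abs_integral_sub_le hf
    (isCompact_setMul (isCompact_singleton (x := x)) hgc) hε0
  obtain ⟨V₂, hV₂, h₂⟩ := hω.exists_nhds_abs_integral_sub_le hg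
    (isCompact_setMul (isCompact_singleton (x := inv x)) hfc) hε0
  -- For a symmetric bump `k` of mass `N`, both sides are compared with `∫ f(s) ∫ k(š * t) dρ(t)
  -- dω(s)`. Integrating over `s` first and using `k(š * t) = k(ť * s)` gives nearly `N ∫ f dρ`.
  -- Integrating over `t` first and reassociating gives an average of `∫ g(y) k(u * y) dω(y)`,
  -- nearly `N g(ǔ)`, over `u ∈ š * x`, hence nearly `N g(x̌ * s)`.
  obtain ⟨k, hk, hkc, hk0, hks, hkV, hkpos⟩ := hω.exists_symmetric_bump (inter_mem hV₁ hV₂)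
  specialize h₁ k hk hkc hk0 fun y hy => (hkV y hy).1
  specialize h₂ k hk hkc hk0 fun y hy => (hkV y hy).2
  set N := ∫ y, k y ∂ω
  have hkT := continuous_realTrans hk hkc
  obtain ⟨C, hC⟩ := hkc.exists_bound_of_continuous hk
  have hgT : Continuous (realTrans g (inv x)) :=
    (continuous_realTrans hg hgc).comp (Continuous.prodMk_right _)
  -- first evaluation
  have e₁ : |∫ s, f s * ∫ t, realTrans k (inv s) t ∂ρ ∂ω - N * ∫ t, f t ∂ρ| ≤
      ε * N * ρ.real univ := by
    have hcc : HasCompactSupport (fun s t => f s * realTrans k (inv s) t).uncurry := by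
      refine HasCompactSupport.intro (hfc.isCompact.prod (isCompact_setMul hfc hkc)) ?_
      rintro ⟨s, t⟩ hst
      by_contra hne
      have hfs : s ∈ tsupport f := subset_tsupport _ (left_ne_zero_of_mul hne)
      exact hst ⟨hfs, mem_setMul_of_realTrans_ne_zero (by rwa [inv_inv])
        (right_ne_zero_of_mul hne)⟩
    have hcu : Continuous (fun s t => f s * realTrans k (inv s) t).uncurry :=
      (hf.comp continuous_fst).mul
        (hkT.comp ((continuous_inv.comp continuous_fst).prodMk continuous_snd))
    simp_rw [← integral_const_mul]
    rw [integral_integral_swap_of_hasCompactSupport hcu hcc]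
    refine abs_integral_sub_integral_le ?_ ((hf.integrable_of_hasCompactSupport hfc).const_mul N) ?_
    · have h1 : Continuous fun t => ∫ s, f s * realTrans k (inv s) t ∂ω := by
        rw [← continuousOn_univ]
        refine continuousOn_integral_of_compact_support hfc.isCompact
          (hcu.comp continuous_swap).continuousOn fun t s _ hs => ?_
        simp [image_eq_zero_of_notMem_tsupport hs]
      refine Integrable.of_bound h1.aestronglyMeasurable (∫ s, |f s| * C ∂ω)
        (.of_forall fun t => ?_)
      refine norm_integral_le_of_norm_le (hfi.abs.mul_const C) (.of_forall fun s => ?_)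
      rw [norm_mul]
      exact mul_le_mul_of_nonneg_left (norm_realTrans_le hC _ _) (norm_nonneg _)
    · filter_upwards [ae_mem_setMul_bind_withCcDensity hg hgc x] with t ht
      simp_rw [fun s => realTrans_inv_comm hk hks s t]
      rw [mul_comm N]
      exact h₁ t ht
  -- second evaluation
  have e₂ : |∫ s, f s * ∫ t, realTrans k (inv s) t ∂ρ ∂ω -
      N * ∫ s, f s * realTrans g (inv x) s ∂ω| ≤ ε * N * ∫ s, |f s| ∂ω := by
    have hkm := hk.stronglyMeasurable_of_hasCompactSupport hkc
    have hE : ∀ s, ∫ t, realTrans k (inv s) t ∂ρ =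
        ∫ u, ∫ y, g y * realTrans k u y ∂ω ∂(conv (inv s) x : Measure K) := fun s => by
      have hF := (isFellerKernel_conv (K := K)).bind (ω.withCcDensity g)
      have h1 := (isFellerKernel_conv_right (inv s)).integral_bind_of_bounded ρ hkm hC
      have h2 := hF.integral_bind_of_bounded (conv (inv s) x : Measure K) hkm hC
      rw [hρ, bind_conv_bind_conv] at h1
      rw [hρ]
      refine h1.symm.trans (h2.trans (integral_congr_ae (.of_forall fun u => ?_)))
      beta_reduce
      rw [(isFellerKernel_conv_right u).integral_bind_of_bounded _ hkm hC,
        integral_withCcDensity hg hg0]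
      rfl
    have hEc : Continuous fun s => ∫ t, realTrans k (inv s) t ∂ρ :=
      continuous_integral_of_bounded ρ (G := fun s t => realTrans k (inv s) t)
        (hkT.comp ((continuous_inv.comp continuous_fst).prodMk continuous_snd))
        fun s t => norm_realTrans_le hC _ _
    have hi1 : Integrable (fun s => f s * ∫ t, realTrans k (inv s) t ∂ρ) ω :=
      (hf.mul hEc).integrable_of_hasCompactSupport hfc.mul_right
    have hi2 : Integrable (fun s => N * (f s * realTrans g (inv x) s)) ω :=
      ((hf.mul hgT).integrable_of_hasCompactSupport hfc.mul_right).const_mul N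
    rw [← integral_const_mul, ← integral_const_mul, ← integral_sub hi1 hi2]
    rw [← Real.norm_eq_abs]
    refine norm_integral_le_of_norm_le (hfi.abs.const_mul _) (.of_forall fun s => ?_)
    rw [show f s * ∫ t, realTrans k (inv s) t ∂ρ - N * (f s * realTrans g (inv x) s) =
      f s * (∫ t, realTrans k (inv s) t ∂ρ - N * realTrans g (inv x) s) by ring, norm_mul,
      mul_comm (ε * N)]
    by_cases hs : f s = 0
    · simp [hs]
    refine mul_le_mul_of_nonneg_left ?_ (norm_nonneg _)
    rw [hE, ← integral_comp_inv_conv hg, ← integral_const_mul]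
    have hcu : Continuous fun u => ∫ y, g y * realTrans k u y ∂ω := by
      rw [← continuousOn_univ]
      refine continuousOn_integral_of_compact_support hgc.isCompact
        ((hg.comp continuous_snd).mul hkT).continuousOn fun u y _ hy => ?_
      simp [image_eq_zero_of_notMem_tsupport hy]
    obtain ⟨D, hD⟩ := hgc.exists_bound_of_continuous hg
    have := abs_integral_sub_integral_le (μ := (conv (inv s) x : Measure K))
      (F := fun u => ∫ y, g y * realTrans k u y ∂ω) (G := fun u => N * g (inv u)) (c := ε * N)
      ?_ ?_ ?_
    · simpa using this
    · refine Integrable.of_bound hcu.aestronglyMeasurable (∫ y, |g y| * C ∂ω)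
        (.of_forall fun u => ?_)
      refine norm_integral_le_of_norm_le
        ((hg.integrable_of_hasCompactSupport hgc).abs.mul_const C) (.of_forall fun y => ?_)
      rw [norm_mul]
      exact mul_le_mul_of_nonneg_left (norm_realTrans_le hC _ _) (norm_nonneg _)
    · exact (Integrable.of_bound (hg.comp continuous_inv).aestronglyMeasurable D
        (.of_forall fun u => hD _)).const_mul N
    · filter_upwards [ae_mem_support (inv s) x] with u hu
      have hu' := inv_mem_support hu
      rw [inv_inv] at hu'
      have := h₂ (inv u) (mem_setMul.2 ⟨_, rfl, s, subset_tsupport _ hs, hu'⟩)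
      rw [inv_inv] at this
      rwa [mul_comm N]
  rw [dist_eq_norm, Real.norm_eq_abs, ← mul_le_mul_iff_right₀ hkpos, ← abs_of_pos hkpos, ← abs_mul,
    abs_of_pos hkpos]
  have e₃ : ε * N * (ρ.real univ + ∫ s, |f s| ∂ω) ≤ N * δ := by
    have : N * δ = ε * N * c := by rw [hε]; field_simp
    rw [this]
    exact mul_le_mul_of_nonneg_left (by rw [hc]; linarith) (by positivity)
  have a := abs_le.1 e₁
  have b := abs_le.1 e₂
  rw [abs_le]
  constructor <;> nlinarith

end Haar
end Hypergroup

/-! ### Convolution by `σ` and smoothing by continuous densities. -/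

namespace Hypergroup

open Filter Set
open scoped Topology NNReal

section Harmonic

variable {K : Type*} [TopologicalSpace K] [T2Space K] [LocallyCompactSpace K]
  [MeasurableSpace K] [BorelSpace K] [Hypergroup K]

/-- The involution as a homeomorphism. -/
def invHomeomorph : K ≃ₜ K where
  toFun := inv
  invFun := inv
  left_inv := inv_inv
  right_inv := inv_inv
  continuous_toFun := continuous_inv
  continuous_invFun := continuous_inv

/-- The kernel `s ↦ σ̌ * δ_s`, which represents `f ↦ σ * f`. -/
noncomputable def convKernel (σ : Measure K) (s : K) : Measure K :=
  (σ.map inv).bind fun y => (conv y s : Measure K)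

theorem regular_map_inv (σ : Measure K) [σ.Regular] : (σ.map inv).Regular :=
  Measure.Regular.map (invHomeomorph (K := K))

theorem isProbabilityMeasure_map_inv (σ : Measure K) [IsProbabilityMeasure σ] :
    IsProbabilityMeasure (σ.map inv) :=
  Measure.isProbabilityMeasure_map continuous_inv.measurable.aemeasurable

theorem integral_map_inv (σ : Measure K) {E : Type*} [NormedAddCommGroup E] [NormedSpace ℝ E]
    (f : K → E) : ∫ y, f y ∂σ.map inv = ∫ y, f (inv y) ∂σ :=
  (invHomeomorph (K := K)).measurableEmbedding.integral_map f

variable {ω : Measure K} {σ : Measure K} [IsProbabilityMeasure σ] [σ.Regular]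

theorem isFellerKernel_convKernel (σ : Measure K) [IsProbabilityMeasure σ] [σ.Regular] :
    IsFellerKernel (convKernel σ) :=
  have := regular_map_inv σ
  have := isProbabilityMeasure_map_inv σ
  isFellerKernel_conv.swap.bind (σ.map inv)

instance isProbabilityMeasure_convKernel (s : K) : IsProbabilityMeasure (convKernel σ s) := by
  have := isProbabilityMeasure_map_inv σ
  refine ⟨?_⟩
  rw [convKernel, (isFellerKernel_conv_left s).bind_apply _ .univ]
  simp

theorem convFun_eq_integral_convKernel {f : K → ℂ} (hf : StronglyMeasurable f) {C : ℝ}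
    (hC : ∀ x, ‖f x‖ ≤ C) (s : K) : convFun σ f s = ∫ t, f t ∂convKernel σ s := by
  have := isProbabilityMeasure_map_inv σ
  rw [convKernel, (isFellerKernel_conv_left s).integral_bind_of_bounded _ hf hC, integral_map_inv]
  rfl

theorem bind_convKernel (ν : Measure K) [IsFiniteMeasure ν] [ν.Regular] :
    ν.bind (convKernel σ) = (σ.map inv).bind fun y => ν.bind fun s => (conv y s : Measure K) :=
  have := regular_map_inv σ
  have := isProbabilityMeasure_map_inv σ
  isFellerKernel_conv.swap.bind_bind_comm ν (σ.map inv)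

/-- Left and right convolutions commute. -/
theorem convKernel_bind (ν : Measure K) [IsFiniteMeasure ν] [ν.Regular] (x : K) :
    (convKernel σ x).bind (fun u => ν.bind fun z => (conv u z : Measure K)) =
      (ν.bind fun z => (conv x z : Measure K)).bind (convKernel σ) := by
  have := regular_map_inv σ
  have := isProbabilityMeasure_map_inv σ
  have := (isFellerKernel_conv_right x).isFiniteMeasure_bind ν
  have := (isFellerKernel_conv_right x).regular_bind ν
  rw [bind_convKernel, convKernel, Measure.bind_bind
    (isFellerKernel_conv_left x).measurable.aemeasurable
    (isFellerKernel_conv.bind ν).measurable.aemeasurable]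
  simp_rw [bind_conv_bind_conv]

/-- Left translates of measures with continuous density. -/
theorem IsLeftHaar.bind_withCcDensity (hω : IsLeftHaar ω) {φ : K → ℝ} (hφ : Continuous φ)
    (hφc : HasCompactSupport φ) (hφ0 : ∀ x, 0 ≤ φ x) (x : K) :
    (ω.withCcDensity φ).bind (fun y => (conv x y : Measure K)) =
      ω.withCcDensity (realTrans φ (inv x)) := by
  have := hω.regular
  have := isFiniteMeasure_withCcDensity (ω := ω) hφ hφc
  have := regular_withCcDensity (ω := ω) hφ hφc
  have hT : Continuous (realTrans φ (inv x)) :=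
    (continuous_realTrans hφ hφc).comp (Continuous.prodMk_right _)
  have := regular_withCcDensity (ω := ω) hT (hasCompactSupport_realTrans hφc _)
  have := (isFellerKernel_conv_right x).regular_bind (ω.withCcDensity φ)
  refine ext_of_integral_eq_of_hasCompactSupport fun g hg hgc => ?_
  rw [hω.integral_bind_withCcDensity hg hgc hφ hφc hφ0,
    integral_withCcDensity hT (realTrans_nonneg hφ0 _)]
  simp only [smul_eq_mul, mul_comm]

theorem ae_of_forall_ae_withCcDensity [SigmaCompactSpace K] {p : K → Prop}
    (h : ∀ φ : K → ℝ, Continuous φ → HasCompactSupport φ → (∀ x, 0 ≤ φ x) →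
      ∀ᵐ x ∂ω.withCcDensity φ, p x) : ∀ᵐ x ∂ω, p x := by
  have hn : ∀ n : ℕ, ∀ᵐ x ∂ω, x ∈ compactCovering K n → p x := fun n => by
    obtain ⟨φ, h1, -, hφc, h01⟩ := exists_continuous_one_zero_of_isCompact
      (isCompact_compactCovering K n) isClosed_empty (disjoint_empty _)
    have := h φ φ.continuous hφc fun x => (h01 x).1
    rw [Measure.withCcDensity, ae_withDensity_iff φ.continuous.measurable.ennreal_ofReal] at this
    filter_upwards [this] with x hx hxn
    refine hx ?_
    rw [h1 hxn]
    simp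
  filter_upwards [ae_all_iff.2 hn] with x hx
  obtain ⟨n, hn⟩ := mem_iUnion.1 ((iUnion_compactCovering K).symm ▸ mem_univ x)
  exact hx n hn

/-- A single `σ̌ * δ_s` may be singular to `ω`. Averaged over `s` against a density `φ`, it becomes
a mixture of the measures `δ_y * φω`, each of which again has a density. -/
theorem IsLeftHaar.ae_ae_convKernel [SigmaCompactSpace K] (hω : IsLeftHaar ω) {p : K → Prop}
    (h : ∀ᵐ x ∂ω, p x) : ∀ᵐ s ∂ω, ∀ᵐ x ∂convKernel σ s, p x := by
  have := hω.regular
  have := isProbabilityMeasure_map_inv σ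
  refine ae_of_forall_ae_withCcDensity fun φ hφ hφc hφ0 => ?_
  have := isFiniteMeasure_withCcDensity (ω := ω) hφ hφc
  have := regular_withCcDensity (ω := ω) hφ hφc
  refine Measure.ae_ae_of_ae_bind (isFellerKernel_convKernel σ).measurable.aemeasurable ?_
  rw [bind_convKernel]
  have hF := isFellerKernel_conv.bind (ω.withCcDensity φ)
  have hac : ((σ.map inv).bind fun y => (ω.withCcDensity φ).bind fun s =>
      (conv y s : Measure K)) ≪ ω := by
    refine Measure.AbsolutelyContinuous.mk fun s hs hs0 => ?_
    rw [hF.bind_apply _ hs]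
    simp_rw [hω.bind_withCcDensity hφ hφc hφ0]
    simp [Measure.withCcDensity_absolutelyContinuous ω _ hs0]
  exact hac.ae_le h

/-- The function `σ * f` depends only on the class of `f`. -/
theorem IsLeftHaar.convFun_congr_ae [SigmaCompactSpace K] (hω : IsLeftHaar ω) {f g : K → ℂ}
    (h : f =ᵐ[ω] g) : convFun σ f =ᵐ[ω] convFun σ g := by
  filter_upwards [hω.ae_ae_convKernel (σ := σ) h] with s hs
  have h1 := Measure.ae_ae_of_ae_bind (isFellerKernel_conv_left s).measurable.aemeasurable hs
  have h2 := ae_of_ae_map continuous_inv.measurable.aemeasurable h1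
  refine integral_congr_ae ?_
  filter_upwards [h2] with y hy using integral_congr_ae hy

/-- The right convolution of a bounded function `f` by a continuous density `φ`. -/
noncomputable def smoothing (ω : Measure K) (φ : K → ℝ) (f : K → ℂ) (x : K) : ℂ :=
  ∫ s, realTrans φ (inv x) s • f s ∂ω

variable {φ : K → ℝ} {f : K → ℂ} {C : ℝ}

/-- The density form of `smoothing` yields continuity; this form, as an integral against `δ_x * φω`,
is the one to which associativity applies. -/
theorem IsLeftHaar.smoothing_eq_integral (hω : IsLeftHaar ω) (hφ : Continuous φ)
    (hφc : HasCompactSupport φ) (hφ0 : ∀ x, 0 ≤ φ x) (f : K → ℂ) (x : K) :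
    smoothing ω φ f x =
      ∫ t, f t ∂(ω.withCcDensity φ).bind (fun y => (conv x y : Measure K)) := by
  rw [hω.bind_withCcDensity hφ hφc hφ0, integral_withCcDensity (φ := realTrans φ (inv x))
    ((continuous_realTrans hφ hφc).comp (Continuous.prodMk_right _)) (realTrans_nonneg hφ0 _)]
  rfl

theorem IsLeftHaar.smoothing_e (hω : IsLeftHaar ω) (hφ : Continuous φ)
    (hφc : HasCompactSupport φ) (hφ0 : ∀ x, 0 ≤ φ x) (f : K → ℂ) :
    smoothing ω φ f e = ∫ x, φ x • f x ∂ω := by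
  rw [hω.smoothing_eq_integral hφ hφc hφ0]
  simp_rw [e_conv]
  rw [Measure.bind_dirac, integral_withCcDensity hφ hφ0]

/-- All regularity comes from `φ`: the weight `φ(x̌ * s)` is jointly continuous, with support in a
fixed compact set as `x` stays near a point, while `f` is only bounded and measurable. -/
theorem continuous_smoothing [ω.Regular] (hφ : Continuous φ) (hφc : HasCompactSupport φ)
    (hf : StronglyMeasurable f) (hC : ∀ x, ‖f x‖ ≤ C) : Continuous (smoothing ω φ f) := by
  rw [continuous_iff_continuousAt]
  intro x
  obtain ⟨Q, hQ, hQx⟩ := exists_compact_mem_nhds x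
  have hk := isCompact_setMul hQ hφc
  refine ContinuousOn.continuousAt (s := Q) ?_ hQx
  refine continuousOn_integral_bilinear_of_locally_integrable_of_compact_support
    (ContinuousLinearMap.lsmul ℝ ℝ : ℝ →L[ℝ] ℂ →L[ℝ] ℂ).flip hk
    (f := fun x s => realTrans φ (inv x) s) ?_ ?_ ?_
  · exact ((continuous_realTrans hφ hφc).comp
      ((continuous_inv.comp continuous_fst).prodMk continuous_snd)).continuousOn
  · intro u s hu hs
    by_contra hne
    exact hs (mem_setMul_of_realTrans_ne_zero (by rwa [inv_inv]) hne)
  · have : IsFiniteMeasure (ω.restrict (setMul Q (tsupport φ))) := ⟨by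
      simpa using hk.measure_lt_top⟩
    exact Integrable.of_bound hf.aestronglyMeasurable C (.of_forall hC)

theorem IsLeftHaar.exists_norm_smoothing_le (hω : IsLeftHaar ω) (hφ : Continuous φ)
    (hφc : HasCompactSupport φ) (hφ0 : ∀ x, 0 ≤ φ x) (hC : ∀ x, ‖f x‖ ≤ C) :
    ∃ B, ∀ x, ‖smoothing ω φ f x‖ ≤ B := by
  have := hω.regular
  have := isFiniteMeasure_withCcDensity (ω := ω) hφ hφc
  have := regular_withCcDensity (ω := ω) hφ hφc
  have hF := (isFellerKernel_conv (K := K)).bind (ω.withCcDensity φ)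
  have := hF.isFiniteMeasure
  obtain ⟨M, hM⟩ := hF.bound
  refine ⟨C * M, fun x => ?_⟩
  rw [hω.smoothing_eq_integral hφ hφc hφ0]
  refine (norm_integral_le_of_norm_le_const (.of_forall hC)).trans ?_
  exact mul_le_mul_of_nonneg_left (ENNReal.toReal_le_coe_of_le_coe (hM x))
    ((norm_nonneg _).trans (hC x))

/-- Smoothings of bounded harmonic functions are harmonic everywhere. -/
theorem IsLeftHaar.integral_smoothing_convKernel (hω : IsLeftHaar ω) (hφ : Continuous φ)
    (hφc : HasCompactSupport φ) (hφ0 : ∀ x, 0 ≤ φ x) (hf : StronglyMeasurable f)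
    (hC : ∀ x, ‖f x‖ ≤ C) (hh : convFun σ f =ᵐ[ω] f) (x : K) :
    ∫ u, smoothing ω φ f u ∂convKernel σ x = smoothing ω φ f x := by
  have := hω.regular
  have := isFiniteMeasure_withCcDensity (ω := ω) hφ hφc
  have := regular_withCcDensity (ω := ω) hφ hφc
  have := (isFellerKernel_conv_right x).isFiniteMeasure_bind (ω.withCcDensity φ)
  have hF := (isFellerKernel_conv (K := K)).bind (ω.withCcDensity φ)
  simp_rw [hω.smoothing_eq_integral hφ hφc hφ0]
  -- Once `σ̌` acts last, harmonicity of `f` is needed only almost everywhere for `δ_x * φω`, which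
  -- is absolutely continuous.
  rw [← hF.integral_bind_of_bounded _ hf hC, convKernel_bind,
    (isFellerKernel_convKernel σ).integral_bind_of_bounded _ hf hC]
  refine integral_congr_ae ?_
  have hac : (ω.withCcDensity φ).bind (fun y => (conv x y : Measure K)) ≪ ω := by
    rw [hω.bind_withCcDensity hφ hφc hφ0]
    exact Measure.withCcDensity_absolutelyContinuous _ _
  filter_upwards [hac.ae_le hh] with s hs
  rw [← convFun_eq_integral_convKernel hf hC, hs]

end Harmonic
end Hypergroup

/-! ### Zero variance, and testing against continuous functions. -/

namespace MeasureTheory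

open Filter Set
open scoped Topology NNReal

/-- The variance `∫ ‖F - c‖² = ∫ ‖F‖² - 2 ⟪c, ∫ F⟫ + ‖c‖²` vanishes. -/
theorem ae_eq_const_of_integral_sq_norm_eq {X : Type*} [MeasurableSpace X] {μ : Measure X}
    [IsProbabilityMeasure μ] {F : X → ℂ} (hF : AEStronglyMeasurable F μ) {C : ℝ}
    (hC : ∀ x, ‖F x‖ ≤ C) {c : ℂ} (h1 : ∫ x, F x ∂μ = c) (h2 : ∫ x, ‖F x‖ ^ 2 ∂μ = ‖c‖ ^ 2) :
    ∀ᵐ x ∂μ, F x = c := by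
  have hi : Integrable F μ := Integrable.of_bound hF C (.of_forall hC)
  have hi2 : Integrable (fun x => ‖F x‖ ^ 2) μ :=
    Integrable.of_bound (hF.norm.pow 2) (C ^ 2) (.of_forall fun x => by
      rw [norm_pow, norm_norm]; gcongr; exact hC x)
  have hi3 : Integrable (fun x => inner ℝ c (F x)) μ := hi.const_inner c
  have hi4 : Integrable (fun x => ‖F x - c‖ ^ 2) μ := by
    simp_rw [norm_sub_sq_real, real_inner_comm c]
    exact (hi2.sub (hi3.const_mul 2)).add (integrable_const _)
  have h0 : ∫ x, ‖F x - c‖ ^ 2 ∂μ = 0 := by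
    have hi5 : Integrable (fun x => ‖F x‖ ^ 2 - 2 * inner ℝ c (F x)) μ :=
      hi2.sub (hi3.const_mul 2)
    simp_rw [norm_sub_sq_real, real_inner_comm c]
    rw [integral_add hi5 (integrable_const _),
      integral_sub hi2 (hi3.const_mul 2), integral_const_mul, integral_inner hi, h1, h2,
      real_inner_self_eq_norm_sq]
    simp
    ring
  filter_upwards [(integral_eq_zero_iff_of_nonneg (fun x => by positivity) hi4).1 h0] with x hx
  simpa [sub_eq_zero] using hx

section

variable {X : Type*} [TopologicalSpace X] [T2Space X] [LocallyCompactSpace X]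
  [MeasurableSpace X] [BorelSpace X] [SigmaCompactSpace X] {ω : Measure X} [ω.Regular]

/-- A bounded function which is orthogonal to all continuous functions with compact support
vanishes almost everywhere. -/
theorem ae_eq_zero_of_forall_integral_smul_eq_zero {h : X → ℂ} (hh : StronglyMeasurable h) {C : ℝ}
    (hC : ∀ x, ‖h x‖ ≤ C)
    (h0 : ∀ ψ : X → ℝ, Continuous ψ → HasCompactSupport ψ → (∀ x, 0 ≤ ψ x) →
      ∫ x, ψ x • h x ∂ω = 0) : h =ᵐ[ω] 0 := by
  refine ae_eq_zero_of_forall_setIntegral_isCompact_eq_zero' ?_ fun Q hQ => ?_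
  · exact LocallyIntegrable.mono (f := fun _ => C) (locallyIntegrable_const C)
      hh.aestronglyMeasurable
      (.of_forall fun x => (hC x).trans (le_abs_self C))
  rcases isEmpty_or_nonempty X with hX | ⟨⟨x₀⟩⟩
  · simp only [integral_of_isEmpty]
  have hC0 : 0 ≤ C := (norm_nonneg _).trans (hC x₀)
  have hQm := hQ.isClosed.measurableSet
  refine norm_le_zero_iff.1 (le_of_forall_pos_le_add fun ε hε => ?_)
  obtain ⟨U, hQU, hU, hμU⟩ := hQ.exists_isOpen_lt_of_lt (μ := ω)
    (ω Q + ENNReal.ofReal (ε / (C + 1)))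
    (ENNReal.lt_add_right hQ.measure_lt_top.ne (by simpa using by positivity))
  obtain ⟨ψ, h1, hψ0, hψc, h01⟩ := exists_continuous_one_zero_of_isCompact hQ
    hU.isClosed_compl (disjoint_compl_right_iff_subset.2 hQU)
  have hUm : ω (U \ Q) < ENNReal.ofReal (ε / (C + 1)) := by
    rw [measure_sdiff hQU hQm.nullMeasurableSet hQ.measure_lt_top.ne]
    exact ENNReal.sub_lt_of_lt_add (measure_mono hQU) (by rwa [add_comm])
  have hUfin : ω (U \ Q) ≠ ∞ := hUm.ne_top
  have hbd : ∀ x, ‖ψ x • h x‖ ≤ ‖ψ x * C‖ := fun x => by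
    rw [norm_smul, norm_mul, Real.norm_of_nonneg hC0]
    exact mul_le_mul_of_nonneg_left (hC x) (norm_nonneg _)
  have hi1 : Integrable (fun x => ψ x • h x) ω :=
    ((ψ.continuous.integrable_of_hasCompactSupport hψc).mul_const C).mono
      (ψ.continuous.aestronglyMeasurable.smul hh.aestronglyMeasurable) (.of_forall hbd)
  have : IsFiniteMeasure (ω.restrict Q) := ⟨by simpa using hQ.measure_lt_top⟩
  have hi2 : Integrable (Q.indicator h) ω := (integrable_indicator_iff hQm).2
    (Integrable.of_bound hh.aestronglyMeasurable C (.of_forall hC))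
  rw [← integral_indicator hQm, ← sub_zero (∫ x, Q.indicator h x ∂ω),
    ← h0 ψ ψ.continuous hψc fun x => (h01 x).1, ← integral_sub hi2 hi1]
  have hUQm : MeasurableSet (U \ Q) := hU.measurableSet.diff hQm
  calc _ ≤ ∫ x, (U \ Q).indicator (fun _ => C) x ∂ω := by
        refine norm_integral_le_of_norm_le ((integrable_indicator_iff hUQm).2
          (integrableOn_const hUfin)) (.of_forall fun x => ?_)
        by_cases hxQ : x ∈ Q
        · simp [hxQ, h1 hxQ]
        · by_cases hxU : x ∈ U
          · have : ‖ψ x • h x‖ ≤ C := by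
              rw [norm_smul, Real.norm_of_nonneg (h01 x).1]
              exact (mul_le_of_le_one_left (norm_nonneg _) (h01 x).2).trans (hC x)
            simpa [hxQ, hxU] using this
          · have hψx : ψ x = 0 := hψ0 hxU
            simp [hxQ, hxU, hψx]
    _ = ω.real (U \ Q) * C := by rw [integral_indicator_const _ hUQm, smul_eq_mul]
    _ ≤ ε / (C + 1) * C := by
        gcongr
        exact (ENNReal.toReal_lt_of_lt_ofReal hUm).le
    _ ≤ 0 + ε := by
        rw [zero_add, div_mul_eq_mul_div, div_le_iff₀ (by positivity)]
        nlinarith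

end

end MeasureTheory

/-! ### Constancy along supports, and recovery of `f` from its smoothings. -/

namespace Hypergroup

open Filter Set
open scoped Topology NNReal

section Harmonic

variable {K : Type*} [TopologicalSpace K] [T2Space K] [LocallyCompactSpace K]
  [MeasurableSpace K] [BorelSpace K] [Hypergroup K]

variable {ω : Measure K} {σ : Measure K} [IsProbabilityMeasure σ] [σ.Regular]

theorem continuous_integral_convKernel {G : K → ℝ} (hG : Continuous G) {C : ℝ}
    (hC : ∀ x, ‖G x‖ ≤ C) : Continuous fun x => ∫ t, G t ∂convKernel σ x := by
  have := regular_map_inv σ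
  have := isProbabilityMeasure_map_inv σ
  simp_rw [convKernel, fun x => (isFellerKernel_conv_left x).integral_bind_of_bounded (σ.map inv)
    hG.stronglyMeasurable hC]
  refine continuous_integral_of_bounded (σ.map inv)
    (G := fun x y => ∫ t, G t ∂(conv y x : Measure K)) (M := C)
    ((continuous_integral_conv hG hC).comp continuous_swap) fun x y => ?_
  simpa using norm_integral_le_of_norm_le_const (μ := (conv y x : Measure K)) (.of_forall hC)

theorem inv_mem_support_map_inv {y : K} (hy : y ∈ σ.support) : inv y ∈ (σ.map inv).support := by
  rw [Measure.mem_support_iff_forall] at hy ⊢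
  intro U hU
  refine (hy _ (continuous_inv.continuousAt.preimage_mem_nhds hU)).trans_le
    (Measure.le_map_apply continuous_inv.measurable.aemeasurable U)

/-- A continuous function which is almost everywhere constant for every measure `σ̌ * δ_x` is
constant. -/
theorem IsNondegenerate.eq_const (hσ : IsNondegenerate σ) {F : K → ℂ} (hF : Continuous F)
    (h : ∀ x, ∀ᵐ t ∂convKernel σ x, F t = F x) (x : K) : F x = F e := by
  have := regular_map_inv σ
  have := isProbabilityMeasure_map_inv σ
  have step : ∀ x, ∀ y ∈ σ.support, ∀ t ∈ (conv (inv y) x : Measure K).support, F t = F x := by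
    intro x y hy t ht
    by_contra hne
    have hU : IsOpen {t | F t ≠ F x} := isOpen_ne_fun hF continuous_const
    refine ((isFellerKernel_conv_left x).measure_bind_pos_iff (σ.map inv) hU).2
      ⟨inv y, inv_mem_support_map_inv hy, ?_⟩ |>.ne' (h x)
    exact (measure_pos_iff_support_inter_nonempty hU).2 ⟨t, ht, hne⟩
  -- Each step multiplies by `b̌` on the left while powers grow on the right, hence the involution:
  -- `x ∈ a * b` gives `x̌ ∈ b̌ * ǎ`, so `F(x̌) = F(ǎ)`.
  have hpow : ∀ n, ∀ x ∈ setPow σ.support n, F (inv x) = F e := by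
    intro n
    induction n with
    | zero =>
      rintro x rfl
      rw [inv_e]
    | succ n ih =>
      intro x hx
      obtain ⟨a, ha, b, hb, hab⟩ := mem_setMul.1 hx
      rw [step _ b hb _ (inv_mem_support hab), ih a ha]
  have hclosed : IsClosed {x | F (inv x) = F e} :=
    isClosed_eq (hF.comp continuous_inv) continuous_const
  have hall : inv x ∈ {x | F (inv x) = F e} := by
    refine closure_minimal (iUnion₂_subset fun n _ => ?_) hclosed (hσ ▸ mem_univ (inv x))
    exact fun x hx => hpow n x hx
  simpa only [mem_ofPred_eq, inv_inv] using hall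

variable {f : K → ℂ} {C : ℝ}

theorem mem_support_conv_e (t : K) : t ∈ (conv t e : Measure K).support := by
  obtain ⟨s, hs⟩ := support_nonempty t (e : K)
  rwa [support_conv_e_subset t hs] at hs

/-- Iterating the convolution of `f` by two continuous densities. -/
theorem IsLeftHaar.integral_smul_smoothing (hω : IsLeftHaar ω) {ψ k : K → ℝ} (hψ : Continuous ψ)
    (hψc : HasCompactSupport ψ) (hψ0 : ∀ x, 0 ≤ ψ x) (hk : Continuous k)
    (hkc : HasCompactSupport k) (hk0 : ∀ x, 0 ≤ k x) (hks : ∀ x, k (inv x) = k x)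
    (hf : StronglyMeasurable f) (hC : ∀ x, ‖f x‖ ≤ C) :
    Continuous (fun t => ∫ x, ψ x * realTrans k (inv t) x ∂ω) ∧
    HasCompactSupport (fun t => ∫ x, ψ x * realTrans k (inv t) x ∂ω) ∧
    ∫ x, ψ x • smoothing ω k f x ∂ω =
      ∫ t, (∫ x, ψ x * realTrans k (inv t) x ∂ω) • f t ∂ω := by
  have := hω.regular
  have := isFiniteMeasure_withCcDensity (ω := ω) hψ hψc
  have := regular_withCcDensity (ω := ω) hψ hψc
  have := isFiniteMeasure_withCcDensity (ω := ω) hk hkc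
  have := regular_withCcDensity (ω := ω) hk hkc
  have hkT := continuous_realTrans hk hkc
  set q : K → ℝ := fun t => ∫ x, ψ x * realTrans k (inv t) x ∂ω with hq
  have hcu : Continuous fun p : K × K => ψ p.2 * realTrans k (inv p.1) p.2 :=
    (hψ.comp continuous_snd).mul
      (hkT.comp ((continuous_inv.comp continuous_fst).prodMk continuous_snd))
  have hqc : Continuous q := by
    rw [← continuousOn_univ]
    refine continuousOn_integral_of_compact_support hψc.isCompact hcu.continuousOn
      fun t x _ hx => ?_
    simp [image_eq_zero_of_notMem_tsupport hx]
  have hq0 : ∀ t, 0 ≤ q t := fun t =>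
    integral_nonneg fun x => mul_nonneg (hψ0 x) (realTrans_nonneg hk0 _ _)
  have hqcc : HasCompactSupport q := by
    refine HasCompactSupport.intro (isCompact_setMul hψc hkc) fun t ht => ?_
    refine integral_eq_zero_of_ae (.of_forall fun x => ?_)
    by_contra hne
    have hx : x ∈ tsupport ψ := subset_tsupport _ (left_ne_zero_of_mul hne)
    have hT := right_ne_zero_of_mul hne
    rw [realTrans_inv_comm hk hks] at hT
    exact ht (mem_setMul_of_realTrans_ne_zero (by rwa [inv_inv]) hT)
  refine ⟨hqc, hqcc, ?_⟩
  have hF := (isFellerKernel_conv (K := K)).bind (ω.withCcDensity k)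
  have := hF.regular_bind (ω.withCcDensity ψ)
  have := regular_withCcDensity (ω := ω) hqc hqcc
  -- In measure form, `ψω * kω = qω`: the adjoint relation moves the translation onto `k`, and
  -- symmetry of `k` identifies the resulting density.
  have key : (ω.withCcDensity ψ).bind (fun x => (ω.withCcDensity k).bind fun z =>
      (conv x z : Measure K)) = ω.withCcDensity q := by
    refine ext_of_integral_eq_of_hasCompactSupport fun g hg hgc => ?_
    obtain ⟨D, hD⟩ := hgc.exists_bound_of_continuous hg
    rw [hF.integral_bind_of_bounded _ (hg.stronglyMeasurable_of_hasCompactSupport hgc) hD,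
      integral_withCcDensity hψ hψ0, integral_withCcDensity hqc hq0]
    simp_rw [hω.integral_bind_withCcDensity hg hgc hk hkc hk0, hq, smul_eq_mul,
      ← integral_const_mul, ← integral_mul_const]
    rw [integral_integral_swap_of_hasCompactSupport]
    · refine integral_congr_ae (.of_forall fun s => integral_congr_ae (.of_forall fun x => ?_))
      beta_reduce
      rw [realTrans_inv_comm hk hks]
      ring
    · exact (hψ.comp continuous_fst).mul ((hg.comp continuous_snd).mul
        (hkT.comp ((continuous_inv.comp continuous_fst).prodMk continuous_snd)))
    · refine HasCompactSupport.intro (hψc.isCompact.prod hgc.isCompact) fun p hp => ?_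
      rw [mem_prod, not_and_or] at hp
      rcases hp with hp | hp <;> simp [Function.uncurry, image_eq_zero_of_notMem_tsupport hp]
  rw [← integral_withCcDensity hqc hq0, ← key, hF.integral_bind_of_bounded _ hf hC,
    integral_withCcDensity hψ hψ0]
  simp_rw [hω.smoothing_eq_integral hk hkc hk0]

/-- If all smoothings of `f` are constant, then averages of `f` against bump functions at the
identity nearly agree with the averages of `f` against any density. -/
theorem IsLeftHaar.exists_nhds_norm_sub_le (hω : IsLeftHaar ω) (hf : StronglyMeasurable f)
    (hC : ∀ x, ‖f x‖ ≤ C)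
    (hconst : ∀ φ : K → ℝ, Continuous φ → HasCompactSupport φ → (∀ x, 0 ≤ φ x) →
      ∀ x, smoothing ω φ f x = smoothing ω φ f e)
    {ψ : K → ℝ} (hψ : Continuous ψ) (hψc : HasCompactSupport ψ) (hψ0 : ∀ x, 0 ≤ ψ x)
    {ε : ℝ} (hε : 0 < ε) :
    ∃ V ∈ 𝓝 (e : K), ∀ k : K → ℝ, Continuous k → HasCompactSupport k → (∀ x, 0 ≤ k x) →
      (∀ x, k (inv x) = k x) → (∀ x, k x ≠ 0 → x ∈ V) →
      ‖(∫ x, ψ x ∂ω) • (∫ x, k x • f x ∂ω) - (∫ x, k x ∂ω) • ∫ x, ψ x • f x ∂ω‖ ≤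
        ε * ∫ x, k x ∂ω := by
  have := hω.regular
  have hC0 : 0 ≤ C := (norm_nonneg _).trans (hC e)
  obtain ⟨W, hW, hWe⟩ := exists_compact_mem_nhds (e : K)
  -- This compact set contains the supports of `ψ` and of every `q` below, independently of `k`, so
  -- a uniform estimate on it controls the integrals.
  set Q := setMul (tsupport ψ) W with hQdef
  have hQ : IsCompact Q := isCompact_setMul hψc hW
  have hQm := hQ.isClosed.measurableSet
  set B := C * ω.real Q with hB
  have hB0 : 0 ≤ B := mul_nonneg hC0 measureReal_nonneg
  obtain ⟨V, hV, hVk⟩ := hω.exists_nhds_abs_integral_sub_le hψ hQ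
    (ε := ε / (B + 1)) (by positivity)
  refine ⟨V ∩ W, inter_mem hV hWe, fun k hk hkc hk0 hks hkV => ?_⟩
  specialize hVk k hk hkc hk0 fun x hx => (hkV x hx).1
  set N := ∫ x, k x ∂ω
  have hN0 : 0 ≤ N := integral_nonneg hk0
  let q : K → ℝ := fun t => ∫ x, ψ x * realTrans k (inv t) x ∂ω
  obtain ⟨hqc, hqcc, heq⟩ : Continuous q ∧ HasCompactSupport q ∧
      ∫ x, ψ x • smoothing ω k f x ∂ω = ∫ t, q t • f t ∂ω :=
    hω.integral_smul_smoothing hψ hψc hψ0 hk hkc hk0 hks hf hC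
  have hsm : ∀ x, smoothing ω k f x = ∫ x, k x • f x ∂ω := fun x => by
    rw [hconst k hk hkc hk0, hω.smoothing_e hk hkc hk0]
  -- As the smoothing is the constant `∫ k f`, its integral against `ψ` is `(∫ ψ)(∫ k f)`; it also
  -- equals `∫ q f`, where `q` is uniformly close to `N ψ`.
  simp_rw [hsm] at heq
  rw [integral_smul_const] at heq
  have hint : ∀ u : K → ℝ, Continuous u → HasCompactSupport u →
      Integrable (fun x => u x • f x) ω := fun u hu huc =>
    ((hu.integrable_of_hasCompactSupport huc).mul_const C).mono
      (hu.aestronglyMeasurable.smul hf.aestronglyMeasurable) (.of_forall fun x => by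
        rw [norm_smul, norm_mul, Real.norm_of_nonneg hC0]
        exact mul_le_mul_of_nonneg_left (hC x) (norm_nonneg _))
  have hiN : Integrable (fun x => N • ψ x • f x) ω := (hint ψ hψ hψc).smul N
  rw [heq, ← integral_smul, ← integral_sub (hint q hqc hqcc) hiN]
  have hfin : ω Q ≠ ∞ := hQ.measure_lt_top.ne
  calc _ ≤ ∫ t, Q.indicator (fun _ => ε / (B + 1) * N * C) t ∂ω := by
        refine norm_integral_le_of_norm_le ((integrable_indicator_iff hQm).2
          (integrableOn_const hfin)) (.of_forall fun t => ?_)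
        rw [smul_smul, ← sub_smul, norm_smul]
        by_cases ht : t ∈ Q
        · rw [indicator_of_mem ht, mul_comm N]
          exact mul_le_mul (hVk t ht) (hC t) (norm_nonneg _) (by positivity)
        · have h1 : ψ t = 0 := by
            by_contra hne
            exact ht (mem_setMul.2 ⟨t, subset_tsupport _ hne, e, mem_of_mem_nhds hWe,
              mem_support_conv_e t⟩)
          have h2 : q t = 0 := by
            refine integral_eq_zero_of_ae (.of_forall fun x => ?_)
            by_contra hne
            have hT := right_ne_zero_of_mul hne
            rw [realTrans_inv_comm hk hks] at hT
            obtain ⟨v, hv, hkv⟩ := exists_mem_support_of_realTrans_ne_zero hT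
            refine ht (mem_setMul.2 ⟨x, subset_tsupport _ (left_ne_zero_of_mul hne), v,
              (hkV v hkv).2, ?_⟩)
            simpa only [inv_inv] using mem_support_inv_left hv
          simp [ht, h1, h2]
    _ = ε / (B + 1) * N * B := by
        rw [integral_indicator_const _ hQm, smul_eq_mul, hB]
        ring
    _ ≤ ε * N := by
        have h1 : ε / (B + 1) * B ≤ ε := by
          rw [div_mul_eq_mul_div, div_le_iff₀ (by positivity)]
          nlinarith
        nlinarith [mul_le_mul_of_nonneg_right h1 hN0]

/-- A bounded function all of whose smoothings are constant is constant. -/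
theorem IsLeftHaar.ae_eq_const_of_smoothing [SigmaCompactSpace K] (hω : IsLeftHaar ω)
    (hf : StronglyMeasurable f) (hC : ∀ x, ‖f x‖ ≤ C)
    (hconst : ∀ φ : K → ℝ, Continuous φ → HasCompactSupport φ → (∀ x, 0 ≤ φ x) →
      ∀ x, smoothing ω φ f x = smoothing ω φ f e) :
    ∃ c : ℂ, f =ᵐ[ω] fun _ => c := by
  have := hω.regular
  have hC0 : 0 ≤ C := (norm_nonneg _).trans (hC e)
  obtain ⟨ψ₀, hψ₀, hψ₀c, hψ₀0, -, -, hψ₀pos⟩ := hω.exists_symmetric_bump (univ_mem (f := 𝓝 (e : K)))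
  set a := ∫ x, ψ₀ x ∂ω
  -- For a bump `k` close to the identity, the averages of `f` against `ψ` and against `ψ₀` both
  -- nearly equal `(∫ k f) / N`; so they agree.
  have key : ∀ ψ : K → ℝ, Continuous ψ → HasCompactSupport ψ → (∀ x, 0 ≤ ψ x) →
      a • ∫ x, ψ x • f x ∂ω = (∫ x, ψ x ∂ω) • ∫ x, ψ₀ x • f x ∂ω := by
    intro ψ hψ hψc hψ0
    set b := ∫ x, ψ x ∂ω
    have hb : 0 ≤ b := integral_nonneg hψ0
    refine eq_of_forall_dist_le fun δ hδ => ?_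
    set ε := δ / (a + b)
    have hε : 0 < ε := by positivity
    obtain ⟨V₁, hV₁, h₁⟩ := hω.exists_nhds_norm_sub_le hf hC hconst hψ hψc hψ0 hε
    obtain ⟨V₂, hV₂, h₂⟩ := hω.exists_nhds_norm_sub_le hf hC hconst hψ₀ hψ₀c hψ₀0 hε
    obtain ⟨k, hk, hkc, hk0, hks, hkV, hkpos⟩ := hω.exists_symmetric_bump (inter_mem hV₁ hV₂)
    specialize h₁ k hk hkc hk0 hks fun x hx => (hkV x hx).1
    specialize h₂ k hk hkc hk0 hks fun x hx => (hkV x hx).2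
    set N := ∫ x, k x ∂ω
    set m := ∫ x, k x • f x ∂ω
    set P := ∫ x, ψ x • f x ∂ω
    set P₀ := ∫ x, ψ₀ x • f x ∂ω
    rw [dist_eq_norm, ← mul_le_mul_iff_right₀ hkpos]
    calc N * ‖a • P - b • P₀‖ = ‖N • (a • P - b • P₀)‖ := by
          rw [norm_smul, Real.norm_of_nonneg hkpos.le]
      _ = ‖b • (a • m - N • P₀) - a • (b • m - N • P)‖ := by
          congr 1
          module
      _ ≤ b * (ε * N) + a * (ε * N) := by
          refine (norm_sub_le _ _).trans (add_le_add ?_ ?_)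
          · rw [norm_smul, Real.norm_of_nonneg hb]
            exact mul_le_mul_of_nonneg_left h₂ hb
          · rw [norm_smul, Real.norm_of_nonneg hψ₀pos.le]
            exact mul_le_mul_of_nonneg_left h₁ hψ₀pos.le
      _ = N * (ε * (a + b)) := by ring
      _ = N * δ := by rw [div_mul_cancel₀ _ (by positivity)]
  set c : ℂ := a⁻¹ • ∫ x, ψ₀ x • f x ∂ω
  refine ⟨c, ?_⟩
  have h := ae_eq_zero_of_forall_integral_smul_eq_zero (ω := ω) (h := fun x => f x - c)
    (C := C + ‖c‖) (hf.sub stronglyMeasurable_const)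
    (fun x => (norm_sub_le _ _).trans (add_le_add_left (hC x) _)) fun ψ hψ hψc hψ0 => by
      have hi := hψ.integrable_of_hasCompactSupport hψc (μ := ω)
      have hi1 : Integrable (fun x => ψ x • f x) ω :=
        (hi.mul_const C).mono
          (hψ.aestronglyMeasurable.smul hf.aestronglyMeasurable) (.of_forall fun x => by
            rw [norm_smul, norm_mul, Real.norm_of_nonneg hC0]
            exact mul_le_mul_of_nonneg_left (hC x) (norm_nonneg _))
      simp_rw [smul_sub]
      rw [integral_sub hi1 (hi.smul_const c), integral_smul_const, sub_eq_zero]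
      rw [smul_comm, ← key ψ hψ hψc hψ0, smul_smul, inv_mul_cancel₀ hψ₀pos.ne', one_smul]
  filter_upwards [h] with x hx
  exact sub_eq_zero.1 hx

end Harmonic
end Hypergroup

/-! ### Representatives in `L^∞` and the conclusion. -/

namespace LInfty

/-- A bound holding only `ω`-almost everywhere says nothing about integrals against measures
singular to `ω`, such as `σ̌ * δ_x` may be. -/
theorem exists_bounded_representative {X : Type*} [MeasurableSpace X] {ω : Measure X}
    (f : Lp ℂ ∞ ω) : ∃ g : X → ℂ, StronglyMeasurable g ∧ (∃ C, ∀ x, ‖g x‖ ≤ C) ∧ f =ᵐ[ω] g := by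
  classical
  have hf := Lp.stronglyMeasurable f
  have hs : MeasurableSet {x | ‖f x‖ ≤ ‖f‖} := hf.norm.measurable measurableSet_Iic
  refine ⟨{x | ‖f x‖ ≤ ‖f‖}.indicator f, hf.indicator hs, ⟨‖f‖, fun x => ?_⟩, ?_⟩
  · by_cases hx : ‖f x‖ ≤ ‖f‖
    · simp [hx]
    · simp [hx]
  · have h : ∀ᵐ x ∂ω, ‖f x‖ ≤ ‖f‖ := by
      filter_upwards [ae_le_eLpNormEssSup (f := f) (μ := ω)] with x hx
      rw [Lp.norm_def, eLpNorm_exponent_top, ← toReal_enorm]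
      exact ENNReal.toReal_mono
        (by rw [← eLpNorm_exponent_top]; exact (Lp.eLpNorm_lt_top f).ne) hx
    filter_upwards [h] with x hx
    rw [Set.indicator_of_mem (s := {x | ‖f x‖ ≤ ‖f‖}) hx]

end LInfty

namespace Hypergroup

open Filter Set
open scoped Topology NNReal ComplexConjugate

section Harmonic

variable {K : Type*} [TopologicalSpace K] [T2Space K] [LocallyCompactSpace K]
  [MeasurableSpace K] [BorelSpace K] [Hypergroup K]

variable {ω : Measure K} {σ : Measure K} [IsProbabilityMeasure σ] [σ.Regular]

theorem IsLeftHaar.mem_harmonicLInfty_iff [SigmaCompactSpace K] (hω : IsLeftHaar ω)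
    {u : Lp ℂ ∞ ω} {F : K → ℂ} (h : u =ᵐ[ω] F) :
    u ∈ harmonicLInfty ω σ ↔ convFun σ F =ᵐ[ω] F := by
  have hc := hω.convFun_congr_ae (σ := σ) h
  exact ⟨fun hu => hc.symm.trans (EventuallyEq.trans (g := u) hu h), fun hF => show convFun σ u =ᵐ[ω] u from hc.trans (hF.trans h.symm)⟩

theorem convFun_const (c : ℂ) : convFun σ (fun _ : K => c) = fun _ => c := by
  ext x
  simp [convFun, trans]

/-- A bounded continuous harmonic function whose squared modulus is harmonic is constant. -/
theorem IsNondegenerate.eq_const_of_subalgebra [SigmaCompactSpace K] (hω : IsLeftHaar ω)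
    (hσ : IsNondegenerate σ) {A : NonUnitalSubalgebra ℂ (Lp ℂ ∞ ω)}
    (hA : (A : Set (Lp ℂ ∞ ω)) = harmonicLInfty ω σ) {F : K → ℂ} (hF : Continuous F) {C : ℝ}
    (hC : ∀ x, ‖F x‖ ≤ C) (hh : ∀ x, ∫ t, F t ∂convKernel σ x = F x) (x : K) : F x = F e := by
  have := hω.regular
  have := hω.isOpenPosMeasure
  -- harmonicity of `F`, of its conjugate and of their product
  have hFm : StronglyMeasurable F := hF.stronglyMeasurable
  have hcF : Continuous fun x => conj (F x) := Complex.continuous_conj.comp hF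
  have hcFm : StronglyMeasurable fun x => conj (F x) :=
    Complex.continuous_conj.comp_stronglyMeasurable hFm
  have hcC : ∀ x, ‖conj (F x)‖ ≤ C := fun x => by rw [RCLike.norm_conj]; exact hC x
  have hm1 : MemLp F ∞ ω := memLp_top_of_bound hFm.aestronglyMeasurable C (.of_forall hC)
  have hm2 : MemLp (fun x => conj (F x)) ∞ ω :=
    memLp_top_of_bound hcFm.aestronglyMeasurable C (.of_forall hcC)
  have hmem1 : hm1.toLp ∈ A := by
    rw [← SetLike.mem_coe, hA, hω.mem_harmonicLInfty_iff hm1.coeFn_toLp]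
    exact .of_forall fun x => by rw [convFun_eq_integral_convKernel hFm hC, hh]
  have hmem2 : hm2.toLp ∈ A := by
    rw [← SetLike.mem_coe, hA, hω.mem_harmonicLInfty_iff hm2.coeFn_toLp]
    exact .of_forall fun x => by
      rw [convFun_eq_integral_convKernel hcFm hcC, integral_conj, hh]
  have hmul : hm1.toLp * hm2.toLp ∈ A := mul_mem hmem1 hmem2
  have hrep : (hm1.toLp * hm2.toLp : Lp ℂ ∞ ω) =ᵐ[ω] fun x => ((‖F x‖ ^ 2 : ℝ) : ℂ) := by
    filter_upwards [LInfty.coeFn_mul hm1.toLp hm2.toLp, hm1.coeFn_toLp, hm2.coeFn_toLp]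
      with x h1 h2 h3
    rw [h1, h2, h3, Complex.mul_conj, Complex.normSq_eq_norm_sq]
  rw [← SetLike.mem_coe, hA, hω.mem_harmonicLInfty_iff hrep] at hmul
  have hG : Continuous fun x => ‖F x‖ ^ 2 := hF.norm.pow 2
  have hGC : ∀ x, ‖(‖F x‖ ^ 2 : ℝ)‖ ≤ C ^ 2 := fun x => by
    rw [norm_pow, norm_norm]
    exact pow_le_pow_left₀ (norm_nonneg _) (hC x) 2
  -- Membership in `A` gives harmonicity of `|F|²` only almost everywhere. Both sides are continuous
  -- and `ω` has full support, so it holds at each `x`, as the variance argument requires.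
  have hsq : (fun x => ∫ t, ‖F t‖ ^ 2 ∂convKernel σ x) = fun x => ‖F x‖ ^ 2 := by
    refine ((continuous_integral_convKernel hG hGC).ae_eq_iff_eq (μ := ω) hG).1 ?_
    filter_upwards [hmul] with x hx
    rw [convFun_eq_integral_convKernel
      (Complex.continuous_ofReal.comp_stronglyMeasurable hG.stronglyMeasurable) (C := C ^ 2)
      (fun x => by rw [Complex.norm_real]; exact hGC x), integral_complex_ofReal] at hx
    exact_mod_cast hx
  exact hσ.eq_const hF (fun x => ae_eq_const_of_integral_sq_norm_eq hFm.aestronglyMeasurable hC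
    (hh x) (congrFun hsq x)) x

theorem IsLeftHaar.smul_one_mem_harmonicLInfty [SigmaCompactSpace K] (hω : IsLeftHaar ω) (c : ℂ) :
    c • (1 : Lp ℂ ∞ ω) ∈ harmonicLInfty ω σ := by
  have h : (c • (1 : Lp ℂ ∞ ω) : Lp ℂ ∞ ω) =ᵐ[ω] fun _ => c := by
    filter_upwards [Lp.coeFn_smul c (1 : Lp ℂ ∞ ω), LInfty.coeFn_one (ω := ω)] with x h1 h2
    rw [h1, Pi.smul_apply, h2, smul_eq_mul, mul_one]
  rw [hω.mem_harmonicLInfty_iff h, convFun_const]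

end Harmonic
end Hypergroup

theorem mainTheorem6 {K : Type*} [TopologicalSpace K] [T2Space K] [LocallyCompactSpace K]
    [MeasurableSpace K] [BorelSpace K] [Hypergroup K]
    (ω : Measure K) (hω : Hypergroup.IsLeftHaar ω)
    (σ : Measure K) [IsProbabilityMeasure σ] [σ.Regular]
    (hσ : Hypergroup.IsNondegenerate σ) :
    (∃ A : NonUnitalSubalgebra ℂ (Lp ℂ ∞ ω),
        (A : Set (Lp ℂ ∞ ω)) = Hypergroup.harmonicLInfty ω σ) ↔
      Hypergroup.harmonicLInfty ω σ = Set.range fun c : ℂ => c • (1 : Lp ℂ ∞ ω) := by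
  have := hσ.sigmaCompactSpace
  have := hω.regular
  constructor
  · rintro ⟨A, hA⟩
    refine Set.Subset.antisymm (fun f hf => ?_)
      (Set.range_subset_iff.2 fun c => hω.smul_one_mem_harmonicLInfty c)
    obtain ⟨g, hg, ⟨C, hC⟩, hfg⟩ := LInfty.exists_bounded_representative f
    have hh := (hω.mem_harmonicLInfty_iff hfg).1 hf
    -- The subalgebra hypothesis is applied to the smoothings of `g`, which are harmonic everywhere,
    -- and not to `g` itself.
    obtain ⟨c, hc⟩ := hω.ae_eq_const_of_smoothing hg hC fun φ hφ hφc hφ0 => by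
      obtain ⟨B, hB⟩ := hω.exists_norm_smoothing_le hφ hφc hφ0 hC
      exact hσ.eq_const_of_subalgebra hω hA (Hypergroup.continuous_smoothing hφ hφc hg hC) hB
        (hω.integral_smoothing_convKernel hφ hφc hφ0 hg hC hh)
    refine ⟨c, Lp.ext ?_⟩
    filter_upwards [hfg, hc, Lp.coeFn_smul c (1 : Lp ℂ ∞ ω), LInfty.coeFn_one (ω := ω)]
      with x h1 h2 h3 h4
    rw [h1, h2, h3, Pi.smul_apply, h4, smul_eq_mul, mul_one]
  · intro h
    refine ⟨(⊥ : Subalgebra ℂ (Lp ℂ ∞ ω)).toNonUnitalSubalgebra, ?_⟩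
    rw [h]
    ext f
    simp [Algebra.mem_bot, Algebra.algebraMap_eq_smul_one]
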